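/- All graphs are finite and simple; $v(G)$ and $e(G)$ denote the numbers of vertices and edges of $G$. A $k$-edge-coloring of $G$ assigns to each edge of $G$ exactly one of $k$ colors (it need not be proper), and $G_i$ denotes the graph on $V(G)$ formed by the edges of color $i$. A monochromatic connected matching of $G$ is a set of pairwise disjoint edges that, for some color $i$, all lie in one connected component of $G_i$. **Theorem.** Let $k\ge 4$ be an integer and let $\varepsilon,\delta$ be real numbers with $0<\varepsilon\le \tfrac12$ and $0\le\delta<\frac{\varepsilon^3}{3k^2}$. Then for every even integer $n\ge 4$, every $k$-edge-colored graph $G$ with $$v(G)>\left(k-\tfrac12+\varepsilon\right)n\qquad\text{and}\qquad e(G)\ge(1-\delta)\binom{v(G)}{2}$$ has a monochromatic connected matching with exactly $n/2$ edges. -/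

import Mathlib

/-- A matching `M` in a graph `H` is connected in `H` if all its edges lie in the same connected
component of `H` (the vertices of a matching are exactly the endpoints of its edges). -/
def IsConnectedMatching {V : Type*} {H : SimpleGraph V} (M : H.Subgraph) : Prop :=
  M.IsMatching ∧ ∃ C : H.ConnectedComponent, M.verts ⊆ C.supp

/-- The edge-colored graph `G` has a monochromatic connected matching with exactly `m` edges:
for some color `i`, the spanning subgraph formed by the edges of color `i` has one. -/
def HasMonochromaticConnectedMatching {V K : Type*} {G : SimpleGraph V}
    (c : G.EdgeLabeling K) (m : ℕ) : Prop :=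
  ∃ (i : K) (M : (c.labelGraph i).Subgraph), IsConnectedMatching M ∧ M.edgeSet.ncard = m

/-! Suppose that no color has the required matching. The Tutte–Berge formula in each component of a
color gives a `StarCover` (`exists_starCover`): every edge of the color joins vertices of one
component and either meets a star vertex or lies inside a part, and the sizes are bounded. By
`sum_pair_le` such a cover contains at most `n` ordered pairs per vertex, and each star vertex
wastes at least `n / 2` of this allowance. Let `N` be the number of vertices and `M` the number of
ordered pairs that no cover contains. All other pairs are covered, so the waste at stars plus the
repeated coverage (`excess`) is at most `N (k n - N) + M`, which is less than `(1/2 - ε) n N + M`.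

Two overlap estimates, both from Cauchy–Schwarz, exceed this budget. Let `U` be the star-free
vertices with few uncovered pairs; almost every vertex is a star or in `U`. A vertex of `U` falls
short of degree `n` by less than `n / 2` in all covers together, and few of its pairs go through
stars. Hence stars are joined to `U` mainly inside parts. This forces stars of one color and
component to share parts of other colors, although their own color already covers these pairs
(`overlap_of_stars`); up to error terms a star then wastes `n` instead of `n / 2`. Moreover, large
parts of different colors must overlap on `U` (`overlap_of_parts`), which costs about `(k - 1) n²
|U|² / N²`. `counts_contradiction` shows that the budget cannot pay for both. -/

/-! ### Real inequalities for the final contradiction -/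

/-- The numerical core: a bound on the size of the star-free part. -/
lemma key_inequality {k N μ ω t : ℝ} (hk : 4 ≤ k) (hN : 7 / 2 ≤ N) (hNk : N ≤ 1003 / 1000 * k)
    (hμ : 0 ≤ μ) (hω : 0 ≤ ω) (ht : 0 ≤ t) (hωt : ω + t ≤ 1 / 2)
    (h : μ * (k - 1) * (1 - 2 * t / k) ^ 2 ≤ ω * N ^ 2) :
    0 ≤ N - 2 * μ - ω - 2 * t + 2 * ω * (μ + ω) := by
  have hk0 : 0 < k := by linarith
  -- The worst case is `k = 4`, `t = 1/2 - ω`.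
  have h1 : 3 / 4 + ω / 2 ≤ 1 - 2 * t / k := by
    have : 2 * t / k ≤ 2 * t / 4 := by gcongr
    linarith
  have h2 : (3 / 4 + ω / 2) ^ 2 ≤ (1 - 2 * t / k) ^ 2 := by gcongr
  have h3 : 747 / 1000 * N ≤ k - 1 := by linarith
  have h4 : μ * (747 / 1000 * N) * (3 / 4 + ω / 2) ^ 2 ≤ ω * N ^ 2 := by
    have : 0 ≤ k - 1 := by linarith
    refine le_trans ?_ h
    gcongr
  have hN0 : 0 < N := by linarith
  have h5 : μ * (747 / 1000) * (3 / 4 + ω / 2) ^ 2 ≤ ω * N := by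
    refine le_of_mul_le_mul_right ?_ hN0
    nlinarith
  -- This is the case `N = 7/2`, the value of `k - 1/2` at `k = 4`. Larger `N` follow in `h7`,
  -- because `(N - 1 + ω + 2 ω²) / N` does not decrease with `N`.
  have h6 : 2 * ω * (1 - ω) * (7 / 2) ≤
      747 / 1000 * (3 / 4 + ω / 2) ^ 2 * (5 / 2 + ω + 2 * ω ^ 2) := by
    have : ω ≤ 1 / 2 := by linarith
    nlinarith [mul_nonneg hω hω, mul_nonneg hω (mul_nonneg hω hω), sq_nonneg (ω - 1 / 3),
      mul_nonneg hω (sq_nonneg (ω - 1 / 3)), mul_nonneg hω (sub_nonneg.2 this)]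
  have h7 : N * (5 / 2 + ω + 2 * ω ^ 2) ≤ 7 / 2 * (N - 1 + ω + 2 * ω ^ 2) := by
    have h8 : 0 ≤ 1 - ω - 2 * ω ^ 2 := by nlinarith
    nlinarith
  have hq : (0 : ℝ) < 747 / 1000 * (3 / 4 + ω / 2) ^ 2 := by positivity
  have h9 : 2 * μ * (1 - ω) ≤ N - 1 + ω + 2 * ω ^ 2 := by
    refine le_of_mul_le_mul_left ?_ hq
    calc 747 / 1000 * (3 / 4 + ω / 2) ^ 2 * (2 * μ * (1 - ω))
        = 2 * (1 - ω) * (μ * (747 / 1000) * (3 / 4 + ω / 2) ^ 2) := by ring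
      _ ≤ 2 * (1 - ω) * (ω * N) := by
          have : 0 ≤ 2 * (1 - ω) := by linarith
          gcongr
      _ = 2 * ω * (1 - ω) * (7 / 2) * (N * (2 / 7)) := by ring
      _ ≤ 747 / 1000 * (3 / 4 + ω / 2) ^ 2 * (5 / 2 + ω + 2 * ω ^ 2) * (N * (2 / 7)) := by gcongr
      _ = 747 / 1000 * (3 / 4 + ω / 2) ^ 2 * (2 / 7 * (N * (5 / 2 + ω + 2 * ω ^ 2))) := by ring
      _ ≤ 747 / 1000 * (3 / 4 + ω / 2) ^ 2 * (2 / 7 * (7 / 2 * (N - 1 + ω + 2 * ω ^ 2))) := by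
          gcongr
      _ = _ := by ring
  nlinarith

/-- In units of `n`, `M` counts uncovered pairs, `R` is the cutoff on uncovered pairs at a vertex of
`U`, and `b` counts the star-free vertices beyond the cutoff. As `δ ≤ 1/384`, `hA` gives `N (1 - δ)
≤ k` and hence the constant `1003/1000`. The other bounds make the errors small against the slack
that `ε` provides. -/
lemma error_bounds {k ε δ N b M R : ℝ} (hk : 4 ≤ k) (hε : 0 < ε)
    (hε' : ε ≤ 1 / 2) (hδ : 0 ≤ δ) (hδ' : δ < ε ^ 3 / (3 * k ^ 2)) (hN0 : 0 < N)
    (hM : M ≤ δ * N ^ 2) (hR : R = ε * N / (4 * k)) (hbR : b * R ≤ M)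
    (hA : 0 ≤ N * (k - N) + M) :
    N ≤ 1003 / 1000 * k ∧ R ≤ ε * N * (1 / 16) ∧ R ≤ ε * (1003 / 4000) ∧
      M ≤ ε * N * (3 / 100) ∧ b ≤ ε * N * (1 / 6) := by
  have hk0 : 0 < k := by linarith
  have hδ1 : δ * (3 * k ^ 2) ≤ ε ^ 3 := by
    rw [lt_div_iff₀ (by positivity)] at hδ'
    exact hδ'.le
  have hε2 : ε ^ 2 ≤ 1 / 4 := by nlinarith
  have hε3 : ε ^ 3 ≤ ε * (1 / 4) := by nlinarith
  have hδ2 : δ ≤ 1 / 384 := by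
    have : δ * (3 * 4 ^ 2) ≤ δ * (3 * k ^ 2) := by gcongr
    linarith
  have hNk : N ≤ 1003 / 1000 * k := by
    have : N * (1 - δ) ≤ k := by
      refine le_of_mul_le_mul_left ?_ hN0
      nlinarith
    nlinarith
  have hR0 : 0 < R := by rw [hR]; positivity
  have hR1 : R ≤ ε * N * (1 / 16) := by
    rw [hR, div_le_iff₀ (by positivity)]
    nlinarith [mul_pos hε hN0]
  have hR2 : R ≤ ε * (1003 / 4000) := by
    rw [hR, div_le_iff₀ (by positivity)]
    nlinarith
  have hδN : δ * N * (12 * k) ≤ ε ^ 3 * (1003 / 250) := by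
    calc δ * N * (12 * k) ≤ δ * (1003 / 1000 * k) * (12 * k) := by gcongr
      _ = δ * (3 * k ^ 2) * (1003 / 250) := by ring
      _ ≤ _ := by gcongr
  have hM1 : M ≤ ε * N * (3 / 100) := by
    have h2 : δ * N * (12 * 4) ≤ δ * N * (12 * k) := by gcongr
    have h3 : δ * N ≤ ε * (3 / 100) := by linarith
    calc M ≤ δ * N * N := by linarith
      _ ≤ ε * (3 / 100) * N := by gcongr
      _ = _ := by ring
  have hb1 : b ≤ ε * N * (1 / 6) := by
    refine le_of_mul_le_mul_right ?_ hR0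
    calc b * R ≤ δ * N ^ 2 := hbR.trans hM
      _ ≤ ε * N * (1 / 6) * R := by
        rw [hR, mul_div_assoc', le_div_iff₀ (by positivity)]
        have h5 : δ * (4 * k) * 4 ≤ δ * (4 * k) * k := by gcongr
        have h7 : δ * (3 * k ^ 2) ≤ ε * (1 / 2) * ε := by
          have : ε ^ 2 * ε ≤ ε ^ 2 * (1 / 2) := by gcongr
          linarith
        have h8 : δ * (4 * k) ≤ ε * (1 / 6) * ε := by linarith
        have h6 : δ * (4 * k) * (N * N) ≤ ε * (1 / 6) * ε * (N * N) :=
          mul_le_mul_of_nonneg_right h8 (by positivity)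
        linarith
  exact ⟨hNk, hR1, hR2, hM1, hb1⟩

/-- The inequalities between the counts of an edge-colored graph without a large monochromatic
connected matching, measured in units of `n`, are contradictory. -/
lemma counts_contradiction {k ε δ N μ W Q G o L Θ M R : ℝ} (hk : 4 ≤ k) (hε : 0 < ε)
    (hε' : ε ≤ 1 / 2) (hδ : 0 ≤ δ) (hδ' : δ < ε ^ 3 / (3 * k ^ 2)) (hN : k - 1 / 2 + ε < N)
    (hμ : 0 ≤ μ) (hW : 0 ≤ W) (hG : 0 ≤ G) (ho : 0 ≤ o) (hΘ : 0 ≤ Θ)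
    (hM : M ≤ δ * N ^ 2) (hR : R = ε * N / (4 * k)) (hb : 0 ≤ N - μ - W)
    (hbR : (N - μ - W) * R ≤ M)
    (hA : W - Q + G + o ≤ N * (k - N) + M) (hB : μ ^ 2 * Q - μ * L ≤ (μ ^ 2 + o) * G)
    (hC : Q ≤ W / 2) (hD : L ≤ μ * R + Θ) (hE : o + Θ ≤ μ * (k - N + R))
    (hF : (k - 1) * (μ - 2 * Θ / k) ^ 2 ≤ o * N ^ 2) : False := by
  have hN0 : 0 < N := by linarith
  obtain ⟨hNk, hR1, hR2, hM1, hb1⟩ := error_bounds hk hε hε' hδ hδ' hN0 hM hR hbR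
    (by linarith)
  have hεN : 0 < ε * N := by positivity
  have hNκ : N * (k - N) ≤ N * (1 / 2 - ε) := by
    have : k - N ≤ 1 / 2 - ε := by linarith
    gcongr
  -- If `μ = 0`, nearly all vertices are stars, and the waste `W / 2` from `hA` and `hC` already
  -- exceeds the budget.
  rcases hμ.eq_or_lt with h0 | h0
  · subst h0
    linarith
  obtain ⟨ω, rfl⟩ : ∃ ω, o = μ * ω := ⟨o / μ, by field_simp⟩
  obtain ⟨t, rfl⟩ : ∃ t, Θ = μ * t := ⟨Θ / μ, by field_simp⟩
  have hω : 0 ≤ ω := by simpa [h0] using ho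
  have ht : 0 ≤ t := by simpa [h0] using hΘ
  have hE' : ω + t ≤ k - N + R := by
    refine le_of_mul_le_mul_left ?_ h0
    linarith
  have hωt : ω + t ≤ 1 / 2 := by linarith
  have hF' : μ * (k - 1) * (1 - 2 * t / k) ^ 2 ≤ ω * N ^ 2 := by
    refine le_of_mul_le_mul_left ?_ h0
    calc μ * (μ * (k - 1) * (1 - 2 * t / k) ^ 2) = (k - 1) * (μ - 2 * (μ * t) / k) ^ 2 := by ring
      _ ≤ _ := hF
      _ = _ := by ring
  have hkey := key_inequality hk (by linarith) hNk hμ hω ht hωt hF'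
  have hB' : μ * (Q - R - t) ≤ (μ + ω) * G := by
    refine le_of_mul_le_mul_left ?_ h0
    have : μ * L ≤ μ * (μ * R + μ * t) := by gcongr
    linarith
  have hQ' : ω * Q ≤ ω * (W / 2) := by gcongr
  have hs : 0 < μ + ω := by linarith
  -- The factor `μ + ω` clears the denominator of the lower bound for `G` in `hB'`. With `Q ≤ W / 2`
  -- and the bound on `N - μ - W`, what remains is `μ` times the quantity in `key_inequality`, up to
  -- errors smaller than the `ε N` slack.
  have hA' : (μ + ω) * (W - Q + G + μ * ω) ≤ (μ + ω) * (N * (1 / 2 - ε) + M) := by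
    refine mul_le_mul_of_nonneg_left ?_ hs.le
    linarith
  have hb2 : (N - μ - W) * (2 * μ + ω) ≤ ε * N * (1 / 6) * (2 * μ + ω) := by gcongr
  have hR3 : μ * R ≤ μ * (ε * N * (1 / 16)) := by gcongr
  have hM2 : (μ + ω) * M ≤ (μ + ω) * (ε * N * (3 / 100)) := by gcongr
  have hkey' := mul_nonneg hμ hkey
  have e1 := mul_pos h0 hεN
  have e2 := mul_nonneg hω hεN.le
  linarith

/-! ### The Tutte–Berge formula -/

open SimpleGraph

/-- A matching contains matchings of every smaller size. -/
lemma SimpleGraph.Subgraph.IsMatching.exists_ncard_eq {α : Type*} [Finite α] {Γ : SimpleGraph α}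
    {M : Γ.Subgraph} (hM : M.IsMatching) {m : ℕ} (hm : m ≤ M.edgeSet.ncard) :
    ∃ M' : Γ.Subgraph, M'.IsMatching ∧ M'.edgeSet.ncard = m := by
  obtain ⟨E, hE, hcard⟩ := Set.exists_subset_card_eq hm
  let M' : Γ.Subgraph :=
    { verts := {a | ∃ b, s(a, b) ∈ E}
      Adj := fun a b => s(a, b) ∈ E
      adj_sub := fun h => M.adj_sub (hE h)
      edge_vert := fun {a b} h => ⟨b, h⟩
      symm := ⟨fun a b h => by rwa [Sym2.eq_swap]⟩ }
  refine ⟨M', ?_, ?_⟩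
  · rintro a ⟨b, hb⟩
    exact ⟨b, hb, fun c hc => hM.eq_of_adj_left (hE hc) (hE hb)⟩
  · rw [← hcard]
    congr 1
    ext e
    induction e with | _ a b => rfl

lemma SimpleGraph.Subgraph.IsMatching.ncard_verts_le {α : Type*} [Finite α] {Γ : SimpleGraph α}
    {M : Γ.Subgraph} (hM : M.IsMatching) : M.verts.ncard ≤ 2 * M.edgeSet.ncard := by
  classical
  have := Fintype.ofFinite α
  have hfin : M.edgeSet.Finite := Set.toFinite _
  have hsub : M.verts ⊆ ((hfin.toFinset.biUnion fun e => e.toFinset : Finset α) : Set α) := by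
    intro a ha
    obtain ⟨b, hb, -⟩ := hM ha
    simp only [Finset.coe_biUnion, Set.mem_iUnion]
    exact ⟨s(a, b), by simpa using hb, by simp⟩
  calc M.verts.ncard ≤ _ := Set.ncard_le_ncard hsub
    _ = _ := Set.ncard_coe_finset _
    _ ≤ hfin.toFinset.card * 2 := by
        refine Finset.card_biUnion_le_card_mul _ _ _ fun e _ => ?_
        induction e with | _ a b =>
          rw [Sym2.toFinset_mk_eq]
          exact Finset.card_le_two
    _ = 2 * M.edgeSet.ncard := by rw [Set.ncard_eq_toFinset_card _ hfin, mul_comm]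

/-- The graph obtained by adding `d` vertices adjacent to all others. -/
def SimpleGraph.addUniversal {α : Type*} (Γ : SimpleGraph α) (d : ℕ) : SimpleGraph (α ⊕ Fin d) where
  Adj x y := x ≠ y ∧ ∀ a b, x = Sum.inl a → y = Sum.inl b → Γ.Adj a b
  symm := ⟨fun _ _ h => ⟨h.1.symm, fun a b ha hb => (h.2 b a hb ha).symm⟩⟩
  loopless := ⟨fun _ h => h.1 rfl⟩

/-- At most `d` vertices of `α` have an added vertex as partner, so at least `2 m` are matched
within `α`. -/
lemma SimpleGraph.exists_isMatching_of_addUniversal {α : Type*} [Finite α] {Γ : SimpleGraph α}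
    {d m : ℕ} (hd : Nat.card α = 2 * m + d) {M : (Γ.addUniversal d).Subgraph}
    (hM : M.IsPerfectMatching) : ∃ M' : Γ.Subgraph, M'.IsMatching ∧ M'.edgeSet.ncard = m := by
  let N : Γ.Subgraph :=
    { verts := {a | ∃ b, M.Adj (Sum.inl a) (Sum.inl b)}
      Adj := fun a b => M.Adj (Sum.inl a) (Sum.inl b)
      adj_sub := fun h => (M.adj_sub h).2 _ _ rfl rfl
      edge_vert := fun {a b} h => ⟨b, h⟩
      symm := ⟨fun a b h => Subgraph.Adj.symm h⟩ }
  have hN : N.IsMatching := by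
    rintro a ⟨b, hb⟩
    exact ⟨b, hb, fun c hc => Sum.inl_injective (hM.1.eq_of_adj_left hc hb)⟩
  refine hN.exists_ncard_eq ?_
  have h1 := hN.ncard_verts_le
  have h2 : N.vertsᶜ.ncard ≤ d := by
    have : ∀ a : (N.vertsᶜ : Set α), ∃ j : Fin d, M.Adj (Sum.inl a.1) (Sum.inr j) := by
      rintro ⟨a, ha⟩
      obtain ⟨b | j, hb, -⟩ := hM.1 (hM.2 (Sum.inl a))
      · exact absurd ⟨b, hb⟩ ha
      · exact ⟨j, hb⟩
    choose f hf using this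
    have hinj : Function.Injective f := by
      intro a b hab
      have := hf b
      rw [← hab] at this
      exact Subtype.ext (Sum.inl_injective (hM.1.eq_of_adj_right (hf a) this))
    simpa [← Nat.card_coe_set_eq] using Nat.card_le_card_of_injective f hinj
  have h3 := Set.ncard_add_ncard_compl N.verts
  omega

/-- The nontrivial direction of the Tutte-Berge formula. -/
lemma SimpleGraph.exists_deficient_set {α : Type*} [Finite α] {Γ : SimpleGraph α} {m : ℕ}
    (hm : 2 * m ≤ Nat.card α) (h : ∀ M : Γ.Subgraph, M.IsMatching → M.edgeSet.ncard ≠ m) :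
    ∃ S : Set α, Nat.card α + S.ncard + 2 ≤
      2 * m + Nat.card (Γ.induce Sᶜ).ConnectedComponent := by
  obtain ⟨d, hd⟩ := Nat.exists_eq_add_of_le hm
  have hno : ¬ ∃ M : (Γ.addUniversal d).Subgraph, M.IsPerfectMatching := by
    rintro ⟨M, hM⟩
    obtain ⟨M', hM', hc⟩ := exists_isMatching_of_addUniversal hd hM
    exact h M' hM' hc
  rw [tutte] at hno
  push Not at hno
  obtain ⟨u, hu⟩ := hno
  rw [IsTutteViolator] at hu
  set Δ := ((⊤ : (Γ.addUniversal d).Subgraph).deleteVerts u).coe with hΔ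
  have hverts : ((⊤ : (Γ.addUniversal d).Subgraph).deleteVerts u).verts = uᶜ := by
    ext; simp
  have hcard : Nat.card ((⊤ : (Γ.addUniversal d).Subgraph).deleteVerts u).verts + u.ncard
      = 2 * m + 2 * d := by
    rw [hverts, Nat.card_coe_set_eq, add_comm, Set.ncard_add_ncard_compl, Nat.card_sum, hd]
    simp
    ring
  have hpar := Δ.odd_ncard_oddComponents
  -- The number of vertices is even, so `u` and the odd components agree in parity and the strict
  -- inequality improves by one. This gain is what later allows two parts in one size bound.
  have hge : u.ncard + 2 ≤ Δ.oddComponents.ncard := by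
    rcases Nat.even_or_odd u.ncard with he | he <;>
    rcases Nat.even_or_odd (Δ.oddComponents.ncard) with ho | ho <;>
    rcases Nat.even_or_odd (Nat.card ((⊤ : (Γ.addUniversal d).Subgraph).deleteVerts u).verts)
      with hv | hv <;> grind
  have hadj : ∀ x y, Δ.Adj x y ↔ (Γ.addUniversal d).Adj x.1 y.1 := by
    intro x y
    have hx : x.1 ∉ u := (Set.ext_iff.1 hverts _).1 x.2
    have hy : y.1 ∉ u := (Set.ext_iff.1 hverts _).1 y.2
    simp only [hΔ, Subgraph.coe_adj, Subgraph.deleteVerts_adj, Subgraph.verts_top, Set.mem_univ,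
      true_and, Subgraph.top_adj]
    exact ⟨fun h => h.2.2, fun h => ⟨hx, hy, h⟩⟩
  -- A surviving added vertex would connect everything, leaving at most one odd component.
  have huniv : ∀ j, Sum.inr j ∈ u := by
    intro j
    by_contra hj
    have hsub : Subsingleton Δ.ConnectedComponent := by
      have : ∀ x, Δ.Reachable x ⟨Sum.inr j, by rw [hverts]; exact hj⟩ := by
        intro x
        by_cases hx : x.1 = Sum.inr j
        · rw [show x = ⟨Sum.inr j, by rw [hverts]; exact hj⟩ from Subtype.ext hx]
        · refine Adj.reachable ((hadj _ _).2 ⟨hx, ?_⟩)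
          intro a b _ hb
          cases hb
      refine ⟨fun C D => ?_⟩
      induction C using ConnectedComponent.ind with | _ x =>
      induction D using ConnectedComponent.ind with | _ y =>
      exact ConnectedComponent.sound ((this x).trans (this y).symm)
    have := Set.ncard_le_one_of_subsingleton Δ.oddComponents
    omega
  refine ⟨Sum.inl ⁻¹' u, ?_⟩
  have hu2 : u.ncard = (Sum.inl ⁻¹' u : Set α).ncard + d := by
    have : u = Sum.inl '' (Sum.inl ⁻¹' u : Set α) ∪ Set.range Sum.inr := by
      ext x
      cases x with
      | inl a => simp
      | inr j => simp [huniv j]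
    conv_lhs => rw [this]
    rw [Set.ncard_union_eq, Set.ncard_image_of_injective _ Sum.inl_injective,
      ← Set.image_univ, Set.ncard_image_of_injective _ Sum.inr_injective]
    · simp
    · rw [Set.disjoint_left]
      rintro _ ⟨a, -, rfl⟩ ⟨j, hj⟩
      cases hj
  let f : Γ.induce (Sum.inl ⁻¹' u : Set α)ᶜ →g Δ :=
    { toFun := fun x => ⟨Sum.inl x.1, by rw [hverts]; exact x.2⟩
      map_rel' := by
        intro x y hxy
        refine (hadj _ _).2 ⟨fun h => hxy.ne (Subtype.ext (Sum.inl_injective h)), ?_⟩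
        rintro a b ha hb
        cases ha
        cases hb
        exact hxy }
  have hsurj : Function.Surjective (ConnectedComponent.map f) := by
    intro C
    induction C using ConnectedComponent.ind with | _ x =>
    obtain ⟨a | j, hx⟩ := x
    · exact ⟨(Γ.induce _).connectedComponentMk ⟨a, by rw [hverts] at hx; exact hx⟩, rfl⟩
    · rw [hverts] at hx
      exact absurd (huniv j) hx
  have h1 := Nat.card_le_card_of_surjective _ hsurj
  have h2 := Set.ncard_le_card Δ.oddComponents
  omega

/-! ### Star covers and their existence -/

section

open scoped Classical

/-- The structure of a graph without a connected matching of `n / 2` edges: the components of the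
graph are the fibers of `comp`, and after deleting the set `star` the components are the fibers
of `part`. -/
structure StarCover (V : Type*) [Fintype V] (n : ℕ) where
  star : Finset V
  comp : V → V
  part : V → V
  -- Labels of parts are vertices of those parts, so `reach` can read the component of a part off
  -- its label.
  part_part : ∀ x, part (part x) = part x
  comp_eq_of_part_eq : ∀ x y, part x = part y → comp x = comp y
  two_mul_card_star_le : ∀ x, 2 * {y ∈ star | comp y = comp x}.card ≤ n
  card_part_add_le : ∀ x ∉ star, ({y | y ∉ star ∧ part y = part x} : Finset V).card +
    2 * {y ∈ star | comp y = comp x}.card ≤ n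
  card_part_add_card_part_le : ∀ x ∉ star, ∀ y ∉ star, comp x = comp y → part x ≠ part y →
    ({z | z ∉ star ∧ part z = part x} : Finset V).card + ({z | z ∉ star ∧ part z = part y} : Finset V).card +
      2 * {z ∈ star | comp z = comp x}.card ≤ n

/-- The pairs that can be edges of a graph with the given structure. -/
def StarCover.Rel {V : Type*} [Fintype V] {n : ℕ} (D : StarCover V n) (x y : V) : Prop :=
  D.comp x = D.comp y ∧ (x ∈ D.star ∨ y ∈ D.star ∨ D.part x = D.part y)

lemma SimpleGraph.ConnectedComponent.mk_out {V : Type*} {H : SimpleGraph V}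
    (C : H.ConnectedComponent) : H.connectedComponentMk C.out = C :=
  Quot.out_eq C

lemma ncard_fiber_add_card_le {β κ : Type*} [Finite β] {f : β → κ} (hf : Function.Surjective f)
    (T : Set κ) : {b | f b ∈ T}.ncard + Nat.card κ ≤ Nat.card β + T.ncard := by
  have := Finite.of_surjective f hf
  have h1 : Tᶜ.ncard ≤ {b | f b ∈ T}ᶜ.ncard := by
    have : Tᶜ = f '' {b | f b ∈ T}ᶜ := by
      ext c
      obtain ⟨b, rfl⟩ := hf c
      simp only [Set.mem_compl_iff, Set.mem_image]
      exact ⟨fun h => ⟨b, h, rfl⟩, by rintro ⟨b', h, he⟩; rw [← he]; exact h⟩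
    rw [this]
    exact Set.ncard_image_le
  have h2 := Set.ncard_add_ncard_compl T
  have h3 := Set.ncard_add_ncard_compl {b | f b ∈ T}
  omega

lemma SimpleGraph.ConnectedComponent.exists_deficient_set {V : Type*} [Finite V]
    {H : SimpleGraph V} {m : ℕ}
    (hno : ∀ M : H.Subgraph, IsConnectedMatching M → M.edgeSet.ncard ≠ m)
    (C : H.ConnectedComponent) : ∃ S : Set C.supp, Nat.card C.supp + S.ncard + 2 ≤
      2 * m + Nat.card ((H.induce C.supp).induce Sᶜ).ConnectedComponent := by
  by_cases hc : 2 * m ≤ Nat.card C.supp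
  · refine SimpleGraph.exists_deficient_set hc fun M hM hcard => ?_
    let f : H.induce C.supp →g H := (Embedding.induce C.supp).toHom
    have hf : Function.Injective f := Subtype.val_injective
    refine hno (M.map f) ⟨hM.map f hf, C, ?_⟩ ?_
    · rintro _ ⟨a, -, rfl⟩
      exact a.2
    · rw [Subgraph.edgeSet_map, Set.ncard_image_of_injective _ (Sym2.map.injective hf), hcard]
  -- Fewer than `2 m` vertices: the empty set works, since at least one component remains.
  · refine ⟨∅, ?_⟩
    obtain ⟨x, hx⟩ := C.nonempty_supp
    have : Nonempty ((H.induce C.supp).induce (∅ : Set C.supp)ᶜ).ConnectedComponent :=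
      ⟨connectedComponentMk _ ⟨⟨x, hx⟩, by simp⟩⟩
    have h1 : 0 < Nat.card ((H.induce C.supp).induce (∅ : Set C.supp)ᶜ).ConnectedComponent :=
      Nat.card_pos
    rw [Set.ncard_empty]
    omega

/-- Parts are nonempty, so parts may be discarded from the Tutte–Berge inequality: any `t` parts of
a component with star set `S` have total size at most `2 m + t - 2 - 2 |S|`. The size bounds of
`StarCover` are the cases `t = 0, 1, 2`. -/
theorem exists_starCover {V : Type*} [Fintype V] {H : SimpleGraph V} {m : ℕ}
    (hno : ∀ M : H.Subgraph, IsConnectedMatching M → M.edgeSet.ncard ≠ m) :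
    ∃ D : StarCover V (2 * m), ∀ x y, H.Adj x y → D.Rel x y := by
  choose Sf hSf using ConnectedComponent.exists_deficient_set hno
  have hmem : ∀ {C : H.ConnectedComponent} {x : V}, x ∈ C.supp ↔ H.connectedComponentMk x = C :=
    Iff.rfl
  let S : Finset V := {x | ⟨x, rfl⟩ ∈ Sf (H.connectedComponentMk x)}
  have hS : ∀ {C : H.ConnectedComponent} {x : V} (hx : x ∈ C.supp), x ∈ S ↔ ⟨x, hx⟩ ∈ Sf C := by
    rintro C x rfl
    simp [S]
  -- Star vertices are kept as isolated vertices, so that `part` is defined on all of `V`.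
  let Hp : SimpleGraph V :=
    { Adj := fun x y => H.Adj x y ∧ x ∉ S ∧ y ∉ S
      symm := ⟨fun x y h => ⟨h.1.symm, h.2.2, h.2.1⟩⟩
      loopless := ⟨fun x h => h.1.ne rfl⟩ }
  let comp : V → V := fun x => (H.connectedComponentMk x).out
  let part : V → V := fun x => (Hp.connectedComponentMk x).out
  have hcomp : ∀ x y, comp x = comp y ↔ H.connectedComponentMk x = H.connectedComponentMk y := by
    intro x y
    refine ⟨fun h => ?_, fun h => by simp only [comp, h]⟩
    have := congrArg H.connectedComponentMk h
    rwa [ConnectedComponent.mk_out,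
      ConnectedComponent.mk_out] at this
  have hpart : ∀ x y, part x = part y ↔ Hp.Reachable x y := by
    intro x y
    rw [← ConnectedComponent.eq]
    refine ⟨fun h => ?_, fun h => by simp only [part, h]⟩
    have := congrArg Hp.connectedComponentMk h
    rwa [ConnectedComponent.mk_out,
      ConnectedComponent.mk_out] at this
  have hle : Hp ≤ H := fun x y h => h.1
  have hpc : ∀ x y, part x = part y → comp x = comp y := fun x y h =>
    (hcomp x y).2 (ConnectedComponent.sound (((hpart x y).1 h).mono hle))
  -- the component of `x` after deleting the star vertices
  let β : H.ConnectedComponent → Type _ := fun C => ((Sf C)ᶜ : Set C.supp)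
  let Γ : ∀ C, SimpleGraph (β C) := fun C => (H.induce C.supp).induce (Sf C)ᶜ
  have hreach : ∀ (C : H.ConnectedComponent) (b b' : β C),
      (Γ C).Reachable b b' ↔ Hp.Reachable b.1.1 b'.1.1 := by
    intro C b b'
    constructor
    · intro h
      let f : Γ C →g Hp :=
        { toFun := fun b => b.1.1
          map_rel' := by
            intro a a' h
            exact ⟨h, fun h' => a.2 ((hS a.1.2).1 h'), fun h' => a'.2 ((hS a'.1.2).1 h')⟩ }
      exact h.map f
    · rintro ⟨p⟩
      have key : ∀ x y (p : Hp.Walk x y) (hx : x ∈ C.supp) (hx' : ⟨x, hx⟩ ∈ (Sf C)ᶜ)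
          (hy : y ∈ C.supp) (hy' : ⟨y, hy⟩ ∈ (Sf C)ᶜ),
          (Γ C).Reachable ⟨⟨x, hx⟩, hx'⟩ ⟨⟨y, hy⟩, hy'⟩ := by
        intro x y p
        induction p with
        | nil => intros; rfl
        | @cons u v w h p ih =>
          intro hx hx' hy hy'
          have hv : v ∈ C.supp := by
            rw [hmem] at hx ⊢
            rw [← hx]
            exact ConnectedComponent.sound h.1.symm.reachable
          have hv' : ⟨v, hv⟩ ∈ (Sf C)ᶜ := fun h' => h.2.2 ((hS hv).2 h')
          have hadj : (Γ C).Adj ⟨⟨u, hx⟩, hx'⟩ ⟨⟨v, hv⟩, hv'⟩ := h.1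
          exact hadj.reachable.trans (ih hv hv' hy hy')
      exact key _ _ p b.1.2 b.2 b'.1.2 b'.2
  have hcard : ∀ C, Nat.card C.supp = (Sf C).ncard + Nat.card (β C) := by
    intro C
    rw [← Set.ncard_add_ncard_compl (Sf C)]
    rfl
  have hsurj : ∀ C, Function.Surjective (Γ C).connectedComponentMk := fun C =>
    Quot.mk_surjective
  have hstar : ∀ x, {y ∈ S | comp y = comp x}.card ≤ (Sf (H.connectedComponentMk x)).ncard := by
    intro x
    rw [← Set.ncard_coe_finset, ← Set.ncard_image_of_injective _ Subtype.val_injective]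
    refine Set.ncard_le_ncard ?_
    intro y hy
    simp only [Finset.coe_filter, Set.mem_ofPred_eq, hcomp] at hy
    exact ⟨⟨y, hy.2⟩, (hS hy.2).1 hy.1, rfl⟩
  have hfib : ∀ (T : Finset V) (C : H.ConnectedComponent), (∀ x ∈ T, x ∉ S ∧ x ∈ C.supp) →
      ({z | z ∉ S ∧ ∃ x ∈ T, part z = part x} : Finset V).card +
        2 * (Sf C).ncard + 2 ≤ 2 * m + (T.image part).card := by
    intro T C hT
    let K : Set (Γ C).ConnectedComponent :=
      {c | ∃ b : β C, b.1.1 ∈ T ∧ (Γ C).connectedComponentMk b = c}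
    have h1 := ncard_fiber_add_card_le (hsurj C) K
    have h2 : ({z | z ∉ S ∧ ∃ x ∈ T, part z = part x} : Finset V).card ≤
        {b | (Γ C).connectedComponentMk b ∈ K}.ncard := by
      rw [← Set.ncard_coe_finset]
      refine le_trans (Set.ncard_le_ncard ?_) (Set.ncard_image_le (f := fun b : β C => b.1.1))
      intro y hy
      simp only [Finset.coe_filter, Set.mem_ofPred_eq, Finset.mem_univ, true_and] at hy
      obtain ⟨hyS, x, hx, hyx⟩ := hy
      have hxC := (hT x hx).2
      have hyC : y ∈ C.supp := by
        rw [hmem] at hxC ⊢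
        rw [← hxC]
        exact (hcomp _ _).1 (hpc _ _ hyx)
      refine ⟨⟨⟨y, hyC⟩, fun h => hyS ((hS hyC).2 h)⟩, ?_, rfl⟩
      refine ⟨⟨⟨x, hxC⟩, fun h => (hT x hx).1 ((hS hxC).2 h)⟩, hx, ?_⟩
      rw [ConnectedComponent.eq, hreach, ← hpart]
      exact hyx.symm
    have h3 : K.ncard ≤ (T.image part).card := by
      let g : (Γ C).ConnectedComponent → V := fun c => part c.out.1.1
      have hg : ∀ b : β C, g ((Γ C).connectedComponentMk b) = part b.1.1 := by
        intro b
        rw [hpart, ← hreach, ← ConnectedComponent.eq]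
        exact ConnectedComponent.mk_out _
      have hinj : Function.Injective g := by
        intro c c' h
        induction c using ConnectedComponent.ind with | _ b =>
        induction c' using ConnectedComponent.ind with | _ b' =>
        rw [hg, hg, hpart, ← hreach] at h
        exact ConnectedComponent.sound h
      rw [← Set.ncard_image_of_injective _ hinj, ← Set.ncard_coe_finset]
      refine Set.ncard_le_ncard ?_
      rintro _ ⟨_, ⟨b, hb, rfl⟩, rfl⟩
      rw [hg]
      simpa using ⟨_, hb, rfl⟩
    have h4 := hSf C
    have h5 := hcard C
    change Nat.card C.supp + _ + 2 ≤ 2 * m + Nat.card (Γ C).ConnectedComponent at h4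
    omega
  refine ⟨⟨S, comp, part, fun x => (hpart _ _).2 (ConnectedComponent.exact
    (ConnectedComponent.mk_out (Hp.connectedComponentMk x))), hpc, ?_, ?_, ?_⟩, ?_⟩
  · intro x
    have h1 := hfib ∅ (H.connectedComponentMk x) (by simp)
    have h2 := hstar x
    simp only [Finset.image_empty, Finset.card_empty] at h1
    omega
  · intro x hx
    have h1 := hfib {x} (H.connectedComponentMk x) (fun z hz => by
      rw [Finset.mem_singleton.1 hz]; exact ⟨hx, rfl⟩)
    have h2 := hstar x
    simp only [Finset.mem_singleton, exists_eq_left, Finset.image_singleton,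
      Finset.card_singleton] at h1
    omega
  · intro x hx y hy hxy hne
    have hxy' := (hcomp x y).1 hxy
    have h1 := hfib {x, y} (H.connectedComponentMk x) (by
      intro z hz
      simp only [Finset.mem_insert, Finset.mem_singleton] at hz
      rcases hz with rfl | rfl
      · exact ⟨hx, rfl⟩
      · exact ⟨hy, hxy'.symm⟩)
    have h2 := hstar x
    have h3 : (Finset.image part {x, y}).card ≤ 2 := by
      rw [Finset.image_insert, Finset.image_singleton]
      exact Finset.card_le_two
    have h4 : ({z | z ∉ S ∧ part z = part x} : Finset V).card + ({z | z ∉ S ∧ part z = part y} : Finset V).card ≤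
        ({z | z ∉ S ∧ ∃ x' ∈ ({x, y} : Finset V), part z = part x'} : Finset V).card := by
      rw [← Finset.card_union_of_disjoint]
      · refine Finset.card_le_card ?_
        intro z hz
        simp only [Finset.mem_union, Finset.mem_filter, Finset.mem_univ, true_and] at hz
        simp only [Finset.mem_filter, Finset.mem_univ, true_and, Finset.mem_insert,
          Finset.mem_singleton, exists_eq_or_imp, exists_eq_left]
        tauto
      · rw [Finset.disjoint_left]
        intro z hz hz'
        simp only [Finset.mem_filter, Finset.mem_univ, true_and] at hz hz'
        exact hne (hz.2.symm.trans hz'.2)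
    omega
  · intro x y hxy
    have hc : comp x = comp y := (hcomp x y).2 (ConnectedComponent.sound hxy.reachable)
    refine ⟨hc, ?_⟩
    by_cases hx : x ∈ S
    · exact Or.inl hx
    by_cases hy : y ∈ S
    · exact Or.inr (Or.inl hy)
    refine Or.inr (Or.inr ((hpart x y).2 (Adj.reachable ?_)))
    exact ⟨hxy, hx, hy⟩

/-! ### Counting in one or two covers -/

namespace StarCover

variable {V : Type*} [Fintype V] {n : ℕ} (D : StarCover V n)

/-- The indicator of `D.Rel`. -/
noncomputable def pair (x y : V) : ℝ := if D.Rel x y then 1 else 0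

/-- The indicator of `x` and `y` lying in the same part. -/
noncomputable def partPair (x y : V) : ℝ :=
  if x ∉ D.star ∧ y ∉ D.star ∧ D.part x = D.part y then 1 else 0

/-- The indicator of `y` being a star vertex of the component of `x`. -/
noncomputable def starPair (x y : V) : ℝ := if y ∈ D.star ∧ D.comp x = D.comp y then 1 else 0

/-- The indicator of the part with label `p`. -/
noncomputable def inPart (p x : V) : ℝ := if x ∉ D.star ∧ D.part x = p then 1 else 0

noncomputable def starDeg (x : V) : ℝ := ∑ y, D.starPair x y

noncomputable def partDeg (x : V) : ℝ := ∑ y, D.partPair x y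

lemma pair_nonneg (x y : V) : 0 ≤ D.pair x y := by unfold pair; split_ifs <;> norm_num

lemma pair_le_one (x y : V) : D.pair x y ≤ 1 := by unfold pair; split_ifs <;> norm_num

lemma partPair_nonneg (x y : V) : 0 ≤ D.partPair x y := by unfold partPair; split_ifs <;> norm_num

lemma starPair_nonneg (x y : V) : 0 ≤ D.starPair x y := by unfold starPair; split_ifs <;> norm_num

lemma starDeg_nonneg (x : V) : 0 ≤ D.starDeg x :=
  Finset.sum_nonneg fun y _ => D.starPair_nonneg x y

lemma pair_eq_of_notMem {x : V} (hx : x ∉ D.star) (y : V) :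
    D.pair x y = D.starPair x y + D.partPair x y := by
  have := D.comp_eq_of_part_eq x y
  unfold pair starPair partPair Rel
  by_cases hy : y ∈ D.star <;> by_cases hp : D.part x = D.part y <;> simp_all

lemma partPair_le_pair (x y : V) : D.partPair x y ≤ D.pair x y := by
  by_cases hx : x ∈ D.star
  · have : D.partPair x y = 0 := by simp [partPair, hx]
    rw [this]
    exact D.pair_nonneg x y
  · rw [D.pair_eq_of_notMem hx]
    linarith [D.starPair_nonneg x y]

lemma starDeg_eq (x : V) : D.starDeg x = ({y ∈ D.star | D.comp y = D.comp x}.card : ℝ) := by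
  unfold starDeg starPair
  rw [Finset.sum_boole]
  congr 2
  ext y
  simp [eq_comm]

lemma partDeg_eq {x : V} (hx : x ∉ D.star) :
    D.partDeg x = (({y | y ∉ D.star ∧ D.part y = D.part x} : Finset V).card : ℝ) := by
  unfold partDeg partPair
  rw [Finset.sum_boole]
  congr 2
  ext y
  simp [eq_comm, hx]

lemma partDeg_add_le {x : V} (hx : x ∉ D.star) : D.partDeg x + 2 * D.starDeg x ≤ n := by
  rw [starDeg_eq, partDeg_eq D hx]
  exact_mod_cast D.card_part_add_le x hx

lemma partDeg_add_partDeg_le {x y : V} (hx : x ∉ D.star) (hy : y ∉ D.star)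
    (hc : D.comp x = D.comp y) (hp : D.part x ≠ D.part y) :
    D.partDeg x + D.partDeg y + 2 * D.starDeg x ≤ n := by
  rw [starDeg_eq, partDeg_eq D hx, partDeg_eq D hy]
  exact_mod_cast D.card_part_add_card_part_le x hx y hy hc hp

lemma starDeg_congr {x y : V} (hc : D.comp x = D.comp y) : D.starDeg x = D.starDeg y := by
  simp only [starDeg, starPair, hc]

lemma sum_inPart_mul (x y : V) : ∑ p, D.inPart p x * D.inPart p y = D.partPair x y := by
  unfold inPart partPair
  rw [Finset.sum_eq_single (D.part x)]
  · by_cases hx : x ∈ D.star <;> simp [hx, eq_comm]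
  · intro p _ hp
    simp [hp.symm]
  · simp

lemma sum_sum_inPart_mul (A B : Finset V) :
    ∑ p, (∑ x ∈ A, D.inPart p x) * (∑ y ∈ B, D.inPart p y) =
      ∑ x ∈ A, ∑ y ∈ B, D.partPair x y := by
  simp_rw [Finset.sum_mul_sum]
  rw [Finset.sum_comm]
  refine Finset.sum_congr rfl fun x _ => ?_
  rw [Finset.sum_comm]
  exact Finset.sum_congr rfl fun y _ => D.sum_inPart_mul x y

/-- A star cover spans at most `n / 2` edges per vertex, and fewer at star vertices. -/
lemma sum_pair_le : ∑ x, ∑ y, D.pair x y + ∑ x ∈ D.star, ((n : ℝ) - D.starDeg x) ≤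
    (Fintype.card V : ℝ) * n := by
  -- Ordered pairs between a star and a non-star are all charged to the non-star. A non-star is thus
  -- charged `partDeg + 2 * starDeg`, at most `n`, and a star only `starDeg`.
  have hpt : ∀ x y, D.pair x y ≤ D.starPair x y + (if y ∈ D.star then 0 else D.starPair y x) +
      D.partPair x y := by
    intro x y
    have hcomm : D.comp y = D.comp x ↔ D.comp x = D.comp y := eq_comm
    unfold pair starPair partPair Rel
    rw [hcomm]
    by_cases hx : x ∈ D.star <;> by_cases hy : y ∈ D.star <;>
      by_cases hp : D.part x = D.part y <;> by_cases hc : D.comp x = D.comp y <;>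
      simp_all
  have hswap : ∑ x, ∑ y, (if y ∈ D.star then 0 else D.starPair y x) =
      ∑ x, (if x ∈ D.star then 0 else D.starDeg x) := by
    rw [Finset.sum_comm]
    refine Finset.sum_congr rfl fun x _ => ?_
    by_cases hx : x ∈ D.star <;> simp [hx, starDeg]
  have hsum : ∑ x ∈ D.star, ((n : ℝ) - D.starDeg x) =
      ∑ x, (if x ∈ D.star then (n : ℝ) - D.starDeg x else 0) := by
    rw [← Finset.sum_filter]
    simp
  calc _ ≤ ∑ x, ∑ y, (D.starPair x y + (if y ∈ D.star then 0 else D.starPair y x) +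
          D.partPair x y) + ∑ x ∈ D.star, ((n : ℝ) - D.starDeg x) := by
        gcongr
        exact hpt _ _
    _ = ∑ x, (D.starDeg x + (if x ∈ D.star then 0 else D.starDeg x) + D.partDeg x +
          (if x ∈ D.star then (n : ℝ) - D.starDeg x else 0)) := by
        rw [hsum]
        simp only [Finset.sum_add_distrib]
        rw [hswap]
        rfl
    _ ≤ ∑ _x : V, (n : ℝ) := by
        refine Finset.sum_le_sum fun x _ => ?_
        by_cases hx : x ∈ D.star
        · have : D.partDeg x = 0 := by simp [partDeg, partPair, hx]
          simp [hx, this]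
        · have := D.partDeg_add_le hx
          simp only [hx, if_false]
          linarith
    _ = _ := by simp

/-- The number of vertices that the part with label `p` and its stars contain. -/
noncomputable def reach (p : V) : ℝ := ∑ y, (D.starPair p y + D.inPart p y)

lemma reach_part {x : V} (hx : x ∉ D.star) : D.reach (D.part x) = D.starDeg x + D.partDeg x := by
  unfold reach starDeg partDeg
  rw [Finset.sum_add_distrib]
  congr 1
  · refine Finset.sum_congr rfl fun y _ => ?_
    simp only [starPair, D.comp_eq_of_part_eq _ _ (D.part_part x)]
  · refine Finset.sum_congr rfl fun y _ => ?_
    simp [inPart, partPair, hx, eq_comm]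

/-- Two different parts meeting `U` cannot share a component: by `partDeg_add_partDeg_le` their
reaches would add up to at most `n`, against `hbig`. So the sets counted by `reach` are disjoint. -/
lemma sum_reach_le {U : Finset V} (hU : ∀ u ∈ U, u ∉ D.star)
    (hbig : ∀ u ∈ U, (n : ℝ) < 2 * (D.starDeg u + D.partDeg u)) :
    ∑ p ∈ U.image D.part, D.reach p ≤ Fintype.card V := by
  unfold reach
  rw [Finset.sum_comm]
  have : ∀ y, ∑ p ∈ U.image D.part, (D.starPair p y + D.inPart p y) ≤ 1 := by
    intro y
    by_cases hne : ∃ p ∈ U.image D.part, D.starPair p y + D.inPart p y ≠ 0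
    · obtain ⟨p, hp, hp0⟩ := hne
      rw [Finset.sum_eq_single_of_mem p hp]
      · unfold starPair inPart
        by_cases hy : y ∈ D.star <;> simp only [hy, true_and, false_and, not_true, not_false_iff,
          if_false] <;> split_ifs <;> norm_num
      · intro p' hp' hne
        by_contra h0
        obtain ⟨u, hu, rfl⟩ := Finset.mem_image.1 hp
        obtain ⟨u', hu', rfl⟩ := Finset.mem_image.1 hp'
        by_cases hy : y ∈ D.star
        · have h1 : D.comp u = D.comp y := by
            rw [← D.comp_eq_of_part_eq _ _ (D.part_part u)]
            by_contra h
            simp [starPair, inPart, hy, h] at hp0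
          have h2 : D.comp u' = D.comp y := by
            rw [← D.comp_eq_of_part_eq _ _ (D.part_part u')]
            by_contra h
            simp [starPair, inPart, hy, h] at h0
          have h3 := D.partDeg_add_partDeg_le (hU u hu) (hU u' hu') (h1.trans h2.symm) hne.symm
          have h4 := D.starDeg_congr (h1.trans h2.symm)
          linarith [hbig u hu, hbig u' hu']
        · have h1 : D.part y = D.part u := by
            by_contra h
            simp [starPair, inPart, hy, h] at hp0
          have h2 : D.part y = D.part u' := by
            by_contra h
            simp [starPair, inPart, hy, h] at h0
          exact hne (h2.symm.trans h1)
    · push Not at hne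
      rw [Finset.sum_eq_zero hne]
      norm_num
  calc _ ≤ ∑ _y : V, (1 : ℝ) := Finset.sum_le_sum fun y _ => this y
    _ = _ := by simp

lemma sum_reach_sq_le {U : Finset V} (hU : ∀ u ∈ U, u ∉ D.star)
    (hbig : ∀ u ∈ U, (n : ℝ) < 2 * (D.starDeg u + D.partDeg u)) :
    ∑ p ∈ U.image D.part, D.reach p ^ 2 ≤ n * Fintype.card V := by
  calc _ ≤ ∑ p ∈ U.image D.part, n * D.reach p := by
        refine Finset.sum_le_sum fun p hp => ?_
        obtain ⟨u, hu, rfl⟩ := Finset.mem_image.1 hp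
        rw [D.reach_part (hU u hu), sq]
        have h1 := D.partDeg_add_le (hU u hu)
        have h2 := D.starDeg_nonneg u
        have h3 := hbig u hu
        have h4 : (0 : ℝ) ≤ n := Nat.cast_nonneg n
        refine mul_le_mul_of_nonneg_right ?_ ?_ <;> linarith
    _ = n * ∑ p ∈ U.image D.part, D.reach p := by rw [Finset.mul_sum]
    _ ≤ _ := by
        gcongr
        exact D.sum_reach_le hU hbig

lemma sum_reach_mul_inPart {U : Finset V} {u : V} (hu : u ∈ U) (hu' : u ∉ D.star) :
    ∑ p ∈ U.image D.part, D.reach p * D.inPart p u = D.starDeg u + D.partDeg u := by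
  rw [← D.reach_part hu', Finset.sum_eq_single_of_mem (D.part u) (Finset.mem_image_of_mem _ hu)]
  · simp [inPart, hu']
  · intro p _ hp
    simp [inPart, hp.symm]

/-- Two covers overlap on a set of vertices whose parts are large in both of them. -/
lemma sq_sum_mul_le (E : StarCover V n) {U : Finset V} (hU : ∀ u ∈ U, u ∉ D.star)
    (hU' : ∀ u ∈ U, u ∉ E.star)
    (hbig : ∀ u ∈ U, (n : ℝ) < 2 * (D.starDeg u + D.partDeg u))
    (hbig' : ∀ u ∈ U, (n : ℝ) < 2 * (E.starDeg u + E.partDeg u)) :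
    (∑ u ∈ U, (D.starDeg u + D.partDeg u) * (E.starDeg u + E.partDeg u)) ^ 2 ≤
      (∑ u ∈ U, ∑ v ∈ U, D.partPair u v * E.partPair u v) * (n * Fintype.card V) ^ 2 := by
  -- Group by pairs of parts and apply Cauchy–Schwarz. One factor is a product of sums of squared
  -- reaches; the other is the sum of squared intersection sizes, which counts pairs sharing a part
  -- in both covers.
  set I := U.image D.part ×ˢ U.image E.part with hI
  have h1 : ∑ u ∈ U, (D.starDeg u + D.partDeg u) * (E.starDeg u + E.partDeg u) =
      ∑ q ∈ I, (D.reach q.1 * E.reach q.2) * ∑ u ∈ U, D.inPart q.1 u * E.inPart q.2 u := by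
    simp_rw [Finset.mul_sum]
    rw [Finset.sum_comm]
    refine Finset.sum_congr rfl fun u hu => ?_
    rw [← D.sum_reach_mul_inPart hu (hU u hu), ← E.sum_reach_mul_inPart hu (hU' u hu),
      Finset.sum_mul_sum, hI, Finset.sum_product]
    exact Finset.sum_congr rfl fun p _ => Finset.sum_congr rfl fun p' _ => by ring
  have h2 : ∑ q ∈ I, (D.reach q.1 * E.reach q.2) ^ 2 ≤ (n * Fintype.card V : ℝ) ^ 2 := by
    rw [hI, Finset.sum_product, sq (n * Fintype.card V : ℝ)]
    simp_rw [mul_pow]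
    rw [← Finset.sum_mul_sum]
    refine mul_le_mul (D.sum_reach_sq_le hU hbig) (E.sum_reach_sq_le hU' hbig') ?_ (by positivity)
    exact Finset.sum_nonneg fun p _ => sq_nonneg _
  have h3 : ∑ q ∈ I, (∑ u ∈ U, D.inPart q.1 u * E.inPart q.2 u) ^ 2 ≤
      ∑ u ∈ U, ∑ v ∈ U, D.partPair u v * E.partPair u v := by
    calc _ ≤ ∑ q : V × V, (∑ u ∈ U, D.inPart q.1 u * E.inPart q.2 u) ^ 2 :=
          Finset.sum_le_sum_of_subset_of_nonneg (Finset.subset_univ _) fun _ _ _ => sq_nonneg _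
      _ = ∑ u ∈ U, ∑ v ∈ U, ∑ q : V × V, (D.inPart q.1 u * E.inPart q.2 u) *
            (D.inPart q.1 v * E.inPart q.2 v) := by
          simp_rw [sq, Finset.sum_mul_sum]
          rw [Finset.sum_comm]
          exact Finset.sum_congr rfl fun u _ => Finset.sum_comm
      _ = _ := by
          refine Finset.sum_congr rfl fun u _ => Finset.sum_congr rfl fun v _ => ?_
          rw [← D.sum_inPart_mul, ← E.sum_inPart_mul, Finset.sum_mul_sum, Fintype.sum_prod_type]
          exact Finset.sum_congr rfl fun p _ => Finset.sum_congr rfl fun p' _ => by ring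
  rw [h1]
  calc _ ≤ _ := Finset.sum_mul_sq_le_sq_mul_sq _ _ _
    _ ≤ (n * Fintype.card V : ℝ) ^ 2 *
        ∑ u ∈ U, ∑ v ∈ U, D.partPair u v * E.partPair u v := by
        refine mul_le_mul h2 h3 ?_ (by positivity)
        exact Finset.sum_nonneg fun p _ => sq_nonneg _
    _ = _ := mul_comm _ _

end StarCover

end

/-! ### Counting over all colors -/

section

open scoped Classical

namespace StarCover

variable {V : Type*} [Fintype V] {n k : ℕ} (D : Fin k → StarCover V n)

/-- The number of covers whose relation contains the pair. -/
noncomputable def cov (x y : V) : ℝ := ∑ i, (D i).pair x y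

/-- The number of covers in which the two vertices lie in the same part. -/
noncomputable def partCov (x y : V) : ℝ := ∑ i, (D i).partPair x y

/-- The indicator of the pairs that no cover contains. -/
noncomputable def uncovered (x y : V) : ℝ := if ∀ i, ¬ (D i).Rel x y then 1 else 0

/-- The number of times that the pair is covered beyond the first. -/
noncomputable def excess (x y : V) : ℝ := cov D x y - 1 + uncovered D x y

lemma uncovered_nonneg (x y : V) : 0 ≤ uncovered D x y := by
  unfold uncovered; split_ifs <;> norm_num

lemma cov_le (x y : V) : cov D x y ≤ k := by
  calc cov D x y ≤ ∑ _i : Fin k, (1 : ℝ) := Finset.sum_le_sum fun i _ => (D i).pair_le_one x y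
    _ = k := by simp

lemma partCov_nonneg (x y : V) : 0 ≤ partCov D x y :=
  Finset.sum_nonneg fun i _ => (D i).partPair_nonneg x y

lemma partCov_le_cov (x y : V) : partCov D x y ≤ cov D x y :=
  Finset.sum_le_sum fun i _ => (D i).partPair_le_pair x y

lemma cov_cases (x y : V) :
    (cov D x y = 0 ∧ uncovered D x y = 1) ∨ (1 ≤ cov D x y ∧ uncovered D x y = 0) := by
  by_cases h : ∀ i, ¬ (D i).Rel x y
  · exact Or.inl ⟨Finset.sum_eq_zero fun i _ => by simp [pair, h i], by simp [uncovered, h]⟩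
  · refine Or.inr ⟨?_, by simp [uncovered, h]⟩
    push Not at h
    obtain ⟨i, hi⟩ := h
    calc (1 : ℝ) = (D i).pair x y := by simp [pair, hi]
      _ ≤ _ := Finset.single_le_sum (fun j _ => (D j).pair_nonneg x y) (Finset.mem_univ i)

lemma one_le_cov_add_uncovered (x y : V) : 1 ≤ cov D x y + uncovered D x y := by
  rcases cov_cases D x y with h | h <;> linarith [h.1, h.2]

lemma excess_nonneg (x y : V) : 0 ≤ excess D x y := by
  unfold excess
  linarith [one_le_cov_add_uncovered D x y]

lemma cov_sub_one_le_excess (x y : V) : cov D x y - 1 ≤ excess D x y := by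
  unfold excess
  linarith [uncovered_nonneg D x y]

lemma cov_mul_sub_one_le (x y : V) : cov D x y * (cov D x y - 1) ≤ k * excess D x y := by
  unfold excess
  have := cov_le D x y
  rcases cov_cases D x y with h | h
  · simp [h.1, h.2]
  · rw [h.2, add_zero]
    exact mul_le_mul_of_nonneg_right this (by linarith [h.1])

lemma sum_excess_add_le : ∑ x, ∑ y, excess D x y +
      ∑ i, ∑ x ∈ (D i).star, ((n : ℝ) - (D i).starDeg x) ≤
    (Fintype.card V : ℝ) * (k * n - Fintype.card V) + ∑ x, ∑ y, uncovered D x y := by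
  have h1 : ∑ x, ∑ y, excess D x y = ∑ i, ∑ x, ∑ y, (D i).pair x y -
      (Fintype.card V : ℝ) * Fintype.card V + ∑ x, ∑ y, uncovered D x y := by
    unfold excess cov
    simp only [Finset.sum_add_distrib, Finset.sum_sub_distrib]
    congr 2
    · exact (Finset.sum_comm.trans (Finset.sum_congr rfl fun x _ => Finset.sum_comm)).symm
    · simp
  have h2 : ∑ i, (∑ x, ∑ y, (D i).pair x y + ∑ x ∈ (D i).star, ((n : ℝ) - (D i).starDeg x)) ≤
      ∑ _i : Fin k, (Fintype.card V : ℝ) * n := Finset.sum_le_sum fun i _ => (D i).sum_pair_le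
  rw [Finset.sum_add_distrib] at h2
  simp only [Finset.sum_const, Finset.card_univ, Fintype.card_fin, nsmul_eq_mul] at h2
  rw [h1]
  linarith

/-- `partCov` is the Gram matrix of the part indicators, so this is Cauchy–Schwarz. -/
lemma sq_sum_partCov_le (A B : Finset V) :
    (∑ x ∈ A, ∑ y ∈ B, partCov D x y) ^ 2 ≤
      (∑ x ∈ A, ∑ y ∈ A, partCov D x y) * (∑ x ∈ B, ∑ y ∈ B, partCov D x y) := by
  have key : ∀ A B : Finset V, ∑ x ∈ A, ∑ y ∈ B, partCov D x y =
      ∑ q : Fin k × V, (∑ x ∈ A, (D q.1).inPart q.2 x) * (∑ y ∈ B, (D q.1).inPart q.2 y) := by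
    intro A B
    rw [Fintype.sum_prod_type]
    simp_rw [sum_sum_inPart_mul, partCov]
    exact (Finset.sum_comm.trans (Finset.sum_congr rfl fun x _ => Finset.sum_comm)).symm
  rw [key A B, key A A, key B B]
  simp_rw [← sq]
  exact Finset.sum_mul_sq_le_sq_mul_sq _ _ _

section Stars

variable (prim : V → Fin k)

/-- The star vertices, where `prim x` is the chosen color of `x`, grouped by color and
component. -/
noncomputable def piece (q : Fin k × V) : Finset V :=
  {x | x ∈ (D (prim x)).star ∧ prim x = q.1 ∧ (D (prim x)).comp x = q.2}

noncomputable def allStars : Finset V := {x | ∃ i, x ∈ (D i).star}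

lemma mem_piece {q : Fin k × V} {x : V} : x ∈ piece D prim q ↔
    x ∈ (D q.1).star ∧ prim x = q.1 ∧ (D q.1).comp x = q.2 := by
  simp only [piece, Finset.mem_filter, Finset.mem_univ, true_and]
  constructor
  · rintro ⟨h1, h2, h3⟩
    rw [h2] at h1 h3
    exact ⟨h1, h2, h3⟩
  · rintro ⟨h1, h2, h3⟩
    rw [h2]
    exact ⟨h1, rfl, h3⟩

variable {prim}

lemma sum_piece (hprim : ∀ x ∈ allStars D, x ∈ (D (prim x)).star) (f : V → ℝ) :
    ∑ q, ∑ x ∈ piece D prim q, f x = ∑ x ∈ allStars D, f x := by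
  rw [← Finset.sum_fiberwise (allStars D) (fun x => (prim x, (D (prim x)).comp x)) f]
  refine Finset.sum_congr rfl fun q _ => Finset.sum_congr ?_ fun _ _ => rfl
  ext x
  simp only [piece, Finset.mem_filter, Finset.mem_univ, true_and, Prod.ext_iff]
  refine and_congr_left fun _ => ⟨fun h => ?_, fun h => hprim x h⟩
  simp only [allStars, Finset.mem_filter, Finset.mem_univ, true_and]
  exact ⟨_, h⟩

lemma piece_subset_filter (q : Fin k × V) :
    piece D prim q ⊆ {x ∈ (D q.1).star | (D q.1).comp x = q.2} := by
  intro x hx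
  rw [mem_piece] at hx
  exact Finset.mem_filter.2 ⟨hx.1, hx.2.2⟩

lemma two_mul_card_filter_le (i : Fin k) (c : V) :
    2 * ({x ∈ (D i).star | (D i).comp x = c}.card : ℝ) ≤ n := by
  rcases Finset.eq_empty_or_nonempty {x ∈ (D i).star | (D i).comp x = c} with h | ⟨x, hx⟩
  · rw [h]; simp
  · have h2 := (Finset.mem_filter.1 hx).2
    have := (D i).two_mul_card_star_le x
    rw [h2] at this
    exact_mod_cast this

lemma two_mul_card_piece_le (q : Fin k × V) : 2 * ((piece D prim q).card : ℝ) ≤ n := by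
  have h1 := two_mul_card_filter_le D q.1 q.2
  have h2 : ((piece D prim q).card : ℝ) ≤ ({x ∈ (D q.1).star | (D q.1).comp x = q.2}.card : ℝ) :=
    by exact_mod_cast Finset.card_le_card (piece_subset_filter D q)
  linarith

lemma sum_card_piece (hprim : ∀ x ∈ allStars D, x ∈ (D (prim x)).star) :
    ∑ q, ((piece D prim q).card : ℝ) = (allStars D).card := by
  have := sum_piece D hprim (fun _ => 1)
  simpa using this

/-- One chosen color per star makes the pieces disjoint. Replacing all stars of a component by its
piece only lowers the waste, since `s (n - s)` increases for `s ≤ n / 2`. -/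
lemma le_sum_sub_starDeg (hprim : ∀ x ∈ allStars D, x ∈ (D (prim x)).star) :
    n * ((allStars D).card : ℝ) - ∑ q, ((piece D prim q).card : ℝ) ^ 2 ≤
      ∑ i, ∑ x ∈ (D i).star, ((n : ℝ) - (D i).starDeg x) := by
  have h1 : ∀ i, ∑ x ∈ (D i).star, ((n : ℝ) - (D i).starDeg x) =
      ∑ c, ({x ∈ (D i).star | (D i).comp x = c}.card : ℝ) *
        (n - ({x ∈ (D i).star | (D i).comp x = c}.card : ℝ)) := by
    intro i
    rw [← Finset.sum_fiberwise (D i).star (D i).comp]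
    refine Finset.sum_congr rfl fun c _ => ?_
    rw [← nsmul_eq_mul, ← Finset.sum_const]
    refine Finset.sum_congr rfl fun x hx => ?_
    rw [starDeg_eq, (Finset.mem_filter.1 hx).2]
  rw [← sum_card_piece D hprim, Finset.mul_sum, ← Finset.sum_sub_distrib]
  simp_rw [h1]
  rw [← Fintype.sum_prod_type (f := fun q : Fin k × V =>
    ({x ∈ (D q.1).star | (D q.1).comp x = q.2}.card : ℝ) *
        (n - ({x ∈ (D q.1).star | (D q.1).comp x = q.2}.card : ℝ)))]
  refine Finset.sum_le_sum fun q _ => ?_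
  have h2 : ((piece D prim q).card : ℝ) ≤ ({x ∈ (D q.1).star | (D q.1).comp x = q.2}.card : ℝ) :=
    by exact_mod_cast Finset.card_le_card (piece_subset_filter D q)
  have h3 := two_mul_card_filter_le D q.1 q.2
  nlinarith

lemma sum_sq_card_piece_le (hprim : ∀ x ∈ allStars D, x ∈ (D (prim x)).star) :
    2 * ∑ q, ((piece D prim q).card : ℝ) ^ 2 ≤ n * ((allStars D).card : ℝ) := by
  rw [← sum_card_piece D hprim, Finset.mul_sum, Finset.mul_sum]
  refine Finset.sum_le_sum fun q _ => ?_
  have := two_mul_card_piece_le D (prim := prim) q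
  have h0 : (0 : ℝ) ≤ (piece D prim q).card := Nat.cast_nonneg _
  nlinarith

/-- The color of the piece covers the pair through its stars and not through a part, so every part
containing the pair is surplus. -/
lemma partCov_le_excess_of_mem_piece {q : Fin k × V} {x y : V} (hx : x ∈ piece D prim q)
    (hy : y ∈ piece D prim q) : partCov D x y ≤ excess D x y := by
  rw [mem_piece] at hx hy
  have h1 : (1 : ℝ) ≤ cov D x y - partCov D x y := by
    unfold cov partCov
    rw [← Finset.sum_sub_distrib]
    calc (1 : ℝ) = (D q.1).pair x y - (D q.1).partPair x y := by
          simp [pair, partPair, Rel, hx.1, hx.2.2, hy.2.2]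
      _ ≤ _ := Finset.single_le_sum
          (fun j _ => sub_nonneg.2 ((D j).partPair_le_pair x y)) (Finset.mem_univ q.1)
  linarith [cov_sub_one_le_excess D x y]

lemma sum_partCov_add_le (hprim : ∀ x ∈ allStars D, x ∈ (D (prim x)).star) {U : Finset V}
    (hU : Disjoint U (allStars D)) :
    ∑ q, ∑ x ∈ piece D prim q, ∑ y ∈ piece D prim q, partCov D x y +
      ∑ u ∈ U, ∑ v ∈ U, excess D u v ≤ ∑ x, ∑ y, excess D x y := by
  have h0 := excess_nonneg D
  have h1 : ∑ q, ∑ x ∈ piece D prim q, ∑ y ∈ piece D prim q, partCov D x y ≤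
      ∑ x ∈ allStars D, ∑ y, excess D x y := by
    rw [← sum_piece D hprim]
    refine Finset.sum_le_sum fun q _ => Finset.sum_le_sum fun x hx => ?_
    calc _ ≤ ∑ y ∈ piece D prim q, excess D x y :=
          Finset.sum_le_sum fun y hy => partCov_le_excess_of_mem_piece D hx hy
      _ ≤ _ := Finset.sum_le_sum_of_subset_of_nonneg (Finset.subset_univ _) fun y _ _ => h0 x y
  have h2 : ∑ u ∈ U, ∑ v ∈ U, excess D u v ≤ ∑ u ∈ U, ∑ y, excess D u y :=
    Finset.sum_le_sum fun x _ =>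
      Finset.sum_le_sum_of_subset_of_nonneg (Finset.subset_univ _) fun y _ _ => h0 x y
  have h3 : ∑ u ∈ U, ∑ y, excess D u y + ∑ x ∈ allStars D, ∑ y, excess D x y ≤
      ∑ x, ∑ y, excess D x y := by
    rw [← Finset.sum_union hU]
    exact Finset.sum_le_sum_of_subset_of_nonneg (Finset.subset_univ _)
      fun x _ _ => Finset.sum_nonneg fun y _ => h0 x y
  linarith

end Stars

lemma sum_partCov_le_sq_add (U : Finset V) :
    ∑ u ∈ U, ∑ v ∈ U, partCov D u v ≤ (U.card : ℝ) ^ 2 + ∑ u ∈ U, ∑ v ∈ U, excess D u v := by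
  have : ((U.card : ℝ)) ^ 2 = ∑ u ∈ U, ∑ v ∈ U, (1 : ℝ) := by simp [sq]
  rw [this, ← Finset.sum_add_distrib]
  refine Finset.sum_le_sum fun u _ => ?_
  rw [← Finset.sum_add_distrib]
  refine Finset.sum_le_sum fun v _ => ?_
  linarith [partCov_le_cov D u v, cov_sub_one_le_excess D u v]

/-- The number of vertices that `u` fails to reach, summed over the covers. -/
noncomputable def defect (i : Fin k) (u : V) : ℝ := n - ((D i).starDeg u + (D i).partDeg u)

lemma starDeg_le_defect {i : Fin k} {u : V} (hu : u ∉ (D i).star) :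
    (D i).starDeg u ≤ defect D i u := by
  have := (D i).partDeg_add_le hu
  unfold defect
  linarith

section StarFree

variable {U : Finset V} (hU : ∀ u ∈ U, ∀ i, u ∉ (D i).star)

include hU

lemma cov_eq {u : V} (hu : u ∈ U) (y : V) :
    cov D u y = ∑ i, (D i).starPair u y + partCov D u y := by
  unfold cov partCov
  rw [← Finset.sum_add_distrib]
  exact Finset.sum_congr rfl fun i _ => (D i).pair_eq_of_notMem (hU u hu i) y

/-- Star vertices of one component have large overlap, as they are joined to the star-free
vertices through parts. -/
lemma overlap_of_stars {prim : V → Fin k} (hprim : ∀ x ∈ allStars D, x ∈ (D (prim x)).star) :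
    (U.card : ℝ) ^ 2 * ∑ q, ((piece D prim q).card : ℝ) ^ 2 -
        n * U.card * ∑ u ∈ U, (∑ y, uncovered D u y + ∑ i, (D i).starDeg u) ≤
      ((U.card : ℝ) ^ 2 + ∑ u ∈ U, ∑ v ∈ U, excess D u v) *
        ∑ q, ∑ x ∈ piece D prim q, ∑ y ∈ piece D prim q, partCov D x y := by
  set ℓ : V → ℝ := fun x => ∑ u ∈ U, (uncovered D u x + ∑ i, (D i).starPair u x) with hℓ
  have hℓ0 : ∀ x, 0 ≤ ℓ x := fun x => Finset.sum_nonneg fun u _ =>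
    add_nonneg (uncovered_nonneg D u x) (Finset.sum_nonneg fun i _ => (D i).starPair_nonneg u x)
  have hL : ∑ q, ∑ x ∈ piece D prim q, ℓ x ≤
      ∑ u ∈ U, (∑ y, uncovered D u y + ∑ i, (D i).starDeg u) := by
    rw [sum_piece D hprim]
    calc _ ≤ ∑ x, ℓ x :=
          Finset.sum_le_sum_of_subset_of_nonneg (Finset.subset_univ _) fun x _ _ => hℓ0 x
      _ = _ := by
          rw [hℓ, Finset.sum_comm]
          refine Finset.sum_congr rfl fun u _ => ?_
          rw [Finset.sum_add_distrib]
          congr 1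
          exact Finset.sum_comm
  -- A pair between `U` and a star is uncovered, uses the star as a star, or lies in a common part;
  -- `ℓ` counts the first two kinds.
  have hlow : ∀ q, (piece D prim q).card * (U.card : ℝ) - ∑ x ∈ piece D prim q, ℓ x ≤
      ∑ x ∈ piece D prim q, ∑ u ∈ U, partCov D x u := by
    intro q
    have : (piece D prim q).card * (U.card : ℝ) = ∑ x ∈ piece D prim q, ∑ u ∈ U, (1 : ℝ) := by simp
    rw [this, ← Finset.sum_sub_distrib]
    refine Finset.sum_le_sum fun x _ => ?_
    rw [hℓ, ← Finset.sum_sub_distrib]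
    refine Finset.sum_le_sum fun u hu => ?_
    have h1 := one_le_cov_add_uncovered D u x
    rw [cov_eq D hU hu] at h1
    have h2 : partCov D x u = partCov D u x := by
      refine Finset.sum_congr rfl fun i _ => ?_
      unfold partPair
      congr 1
      grind
    rw [h2]
    linarith
  have hX := sum_partCov_le_sq_add D U
  have hq : ∀ q, (U.card : ℝ) ^ 2 * ((piece D prim q).card : ℝ) ^ 2 -
      n * U.card * ∑ x ∈ piece D prim q, ℓ x ≤
      ((U.card : ℝ) ^ 2 + ∑ u ∈ U, ∑ v ∈ U, excess D u v) *
        ∑ x ∈ piece D prim q, ∑ y ∈ piece D prim q, partCov D x y := by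
    intro q
    have h1 := hlow q
    have h2 := sq_sum_partCov_le D (piece D prim q) U
    have h3 : 0 ≤ ∑ x ∈ piece D prim q, ∑ y ∈ piece D prim q, partCov D x y :=
      Finset.sum_nonneg fun x _ => Finset.sum_nonneg fun y _ => partCov_nonneg D x y
    have h4 := mul_le_mul_of_nonneg_left hX h3
    have h5 := two_mul_card_piece_le D (prim := prim) q
    have h6 : 0 ≤ ∑ x ∈ piece D prim q, ℓ x := Finset.sum_nonneg fun x _ => hℓ0 x
    set s : ℝ := ((piece D prim q).card : ℝ)
    set μ : ℝ := (U.card : ℝ)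
    set e := ∑ x ∈ piece D prim q, ∑ u ∈ U, partCov D x u
    set l := ∑ x ∈ piece D prim q, ℓ x
    have hs : 0 ≤ s := Nat.cast_nonneg _
    have hμ : 0 ≤ μ := Nat.cast_nonneg _
    have h7 : 2 * s * (μ * l) ≤ n * (μ * l) := by gcongr
    have h8 : s * μ * (s * μ - l) ≤ s * μ * e := by gcongr
    -- The tangent bound `e² ≥ 2 s μ e - (s μ)²` works whatever the sign of `s μ - l`.
    have h9 := sq_nonneg (e - s * μ)
    linarith
  calc _ ≤ (U.card : ℝ) ^ 2 * ∑ q, ((piece D prim q).card : ℝ) ^ 2 -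
        n * U.card * ∑ q, ∑ x ∈ piece D prim q, ℓ x := by gcongr
    _ = ∑ q, ((U.card : ℝ) ^ 2 * ((piece D prim q).card : ℝ) ^ 2 -
          n * U.card * ∑ x ∈ piece D prim q, ℓ x) := by
        rw [Finset.sum_sub_distrib, Finset.mul_sum, Finset.mul_sum]
    _ ≤ _ := by
        rw [Finset.mul_sum]
        exact Finset.sum_le_sum fun q _ => hq q

lemma sum_excess_add_sum_defect {u : V} (hu : u ∈ U) :
    ∑ y, excess D u y + ∑ i, defect D i u =
      k * n - Fintype.card V + ∑ y, uncovered D u y := by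
  have h1 : ∑ y, cov D u y = ∑ i, ((D i).starDeg u + (D i).partDeg u) := by
    unfold cov
    rw [Finset.sum_comm]
    refine Finset.sum_congr rfl fun i _ => ?_
    unfold starDeg partDeg
    rw [← Finset.sum_add_distrib]
    exact Finset.sum_congr rfl fun y _ => (D i).pair_eq_of_notMem (hU u hu i) y
  unfold excess defect
  rw [Finset.sum_add_distrib, Finset.sum_sub_distrib, Finset.sum_sub_distrib, h1]
  simp
  ring

/-- Inside `U` pairs are covered by parts only, so the colors contribute `cov * (cov - 1)` for each
pair of vertices. -/
lemma sum_offDiag_partPair_le :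
    ∑ q ∈ (Finset.univ : Finset (Fin k)).offDiag,
      ∑ u ∈ U, ∑ v ∈ U, (D q.1).partPair u v * (D q.2).partPair u v ≤
      k * ∑ u ∈ U, ∑ v ∈ U, excess D u v := by
  rw [Finset.sum_comm, Finset.mul_sum]
  refine Finset.sum_le_sum fun u hu => ?_
  rw [Finset.sum_comm, Finset.mul_sum]
  refine Finset.sum_le_sum fun v hv => ?_
  refine le_trans (le_of_eq ?_) (cov_mul_sub_one_le D u v)
  have h1 : cov D u v = partCov D u v := by
    rw [cov_eq D hU hu, Finset.sum_eq_zero, zero_add]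
    intro i _
    simp [starPair, hU v hv i]
  have h2 : partCov D u v = ∑ q ∈ (Finset.univ : Finset (Fin k)).diag,
      (D q.1).partPair u v * (D q.2).partPair u v := by
    rw [Finset.sum_diag]
    refine Finset.sum_congr rfl fun i _ => ?_
    unfold partPair
    split_ifs <;> simp
  have h3 : partCov D u v * partCov D u v = ∑ q ∈ (Finset.univ : Finset (Fin k)).diag,
      (D q.1).partPair u v * (D q.2).partPair u v +
      ∑ q ∈ (Finset.univ : Finset (Fin k)).offDiag,
      (D q.1).partPair u v * (D q.2).partPair u v := by
    rw [← Finset.sum_union (Finset.disjoint_diag_offDiag _), Finset.diag_union_offDiag,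
      Finset.sum_product, partCov, Finset.sum_mul_sum]
  rw [h1, mul_sub, mul_one, h3]
  linarith

/-- Parts of different covers overlap on the star-free vertices. -/
lemma overlap_of_parts (hn : 0 < n) (hk : 2 ≤ k)
    (hbig : ∀ u ∈ U, ∀ i, 2 * defect D i u < n)
    (hdef : ∀ u ∈ U, ∑ i, defect D i u ≤ n) :
    ((k : ℝ) - 1) * (n * U.card - 2 * (∑ u ∈ U, ∑ i, defect D i u) / k) ^ 2 ≤
      (∑ u ∈ U, ∑ v ∈ U, excess D u v) * (Fintype.card V : ℝ) ^ 2 := by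
  have hn' : (0 : ℝ) < n := by exact_mod_cast hn
  have hk' : (2 : ℝ) ≤ k := by exact_mod_cast hk
  have hτ0 : ∀ u ∈ U, ∀ i, 0 ≤ defect D i u := fun u hu i =>
    ((D i).starDeg_nonneg u).trans (starDeg_le_defect D (hU u hu i))
  set Θ : Fin k → ℝ := fun i => ∑ u ∈ U, defect D i u with hΘ
  set o : Fin k × Fin k → ℝ := fun q =>
    ∑ u ∈ U, ∑ v ∈ U, (D q.1).partPair u v * (D q.2).partPair u v with ho
  have hΘsum : ∑ u ∈ U, ∑ i, defect D i u = ∑ i, Θ i := Finset.sum_comm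
  have hΘle : ∑ i, Θ i ≤ n * U.card := by
    rw [← hΘsum]
    calc _ ≤ ∑ u ∈ U, (n : ℝ) := Finset.sum_le_sum hdef
      _ = _ := by simp [mul_comm]
  have hpair : ∀ q ∈ (Finset.univ : Finset (Fin k)).offDiag,
      (n * (U.card : ℝ) - Θ q.1 - Θ q.2) ^ 2 ≤ o q * (Fintype.card V : ℝ) ^ 2 := by
    intro q hq
    have hne : q.1 ≠ q.2 := (Finset.mem_offDiag.1 hq).2.2
    have hbig' : ∀ i, ∀ u ∈ U, (n : ℝ) < 2 * ((D i).starDeg u + (D i).partDeg u) := by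
      intro i u hu
      have := hbig u hu i
      unfold defect at this
      linarith
    have h1 := (D q.1).sq_sum_mul_le (D q.2) (fun u hu => hU u hu _) (fun u hu => hU u hu _)
      (hbig' _) (hbig' _)
    have h2 : n * (n * (U.card : ℝ) - Θ q.1 - Θ q.2) ≤
        ∑ u ∈ U, ((D q.1).starDeg u + (D q.1).partDeg u) *
          ((D q.2).starDeg u + (D q.2).partDeg u) := by
      have : n * (n * (U.card : ℝ) - Θ q.1 - Θ q.2) =
          ∑ u ∈ U, (n * (n - defect D q.1 u - defect D q.2 u) : ℝ) := by
        rw [← Finset.mul_sum, Finset.sum_sub_distrib, Finset.sum_sub_distrib]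
        simp [hΘ, mul_comm]
      rw [this]
      refine Finset.sum_le_sum fun u hu => ?_
      -- For `a, b ≥ 0`, `(n - a) (n - b) ≥ n (n - a - b)`.
      have e1 := mul_nonneg (hτ0 u hu q.1) (hτ0 u hu q.2)
      unfold defect at e1 ⊢
      linarith
    have h3 : 0 ≤ n * (U.card : ℝ) - Θ q.1 - Θ q.2 := by
      have : Θ q.1 + Θ q.2 ≤ ∑ i, Θ i := by
        rw [← Finset.sum_pair hne]
        exact Finset.sum_le_sum_of_subset_of_nonneg (Finset.subset_univ _)
          fun i _ _ => Finset.sum_nonneg fun u hu => hτ0 u hu i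
      linarith
    have h4 : (n * (n * (U.card : ℝ) - Θ q.1 - Θ q.2)) ^ 2 ≤
        o q * (n * Fintype.card V : ℝ) ^ 2 := by
      refine le_trans ?_ h1
      gcongr
    refine le_of_mul_le_mul_left ?_ (pow_pos hn' 2)
    linarith
  have hsum := Finset.sum_le_sum hpair
  rw [← Finset.sum_mul] at hsum
  have hoff := sum_offDiag_partPair_le D hU
  set c : ℝ := n * U.card - 2 * (∑ i, Θ i) / k with hc
  have hcard : ((Finset.univ : Finset (Fin k)).offDiag.card : ℝ) = k * (k - 1) := by
    rw [Finset.offDiag_card, Nat.cast_sub (Nat.le_mul_self _)]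
    simp
    ring
  have hfst : ∑ q ∈ (Finset.univ : Finset (Fin k)).offDiag, (Θ q.1 + Θ q.2) =
      2 * (k - 1) * ∑ i, Θ i := by
    have e1 : ∑ q ∈ (Finset.univ : Finset (Fin k)).diag, (Θ q.1 + Θ q.2) +
        ∑ q ∈ (Finset.univ : Finset (Fin k)).offDiag, (Θ q.1 + Θ q.2) = 2 * k * ∑ i, Θ i := by
      rw [← Finset.sum_union (Finset.disjoint_diag_offDiag _), Finset.diag_union_offDiag,
        Finset.sum_product]
      simp only [Finset.sum_add_distrib, Finset.sum_const, Finset.card_univ, Fintype.card_fin,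
        nsmul_eq_mul, ← Finset.mul_sum]
      ring
    rw [Finset.sum_diag, Finset.sum_add_distrib] at e1
    linarith
  -- Convexity of the square: `c` is the mean of `n |U| - Θ i - Θ j` over `i ≠ j`, and each square
  -- is bounded below by its tangent at `c`.
  have hlin : (k : ℝ) * (k - 1) * c ^ 2 ≤
      ∑ q ∈ (Finset.univ : Finset (Fin k)).offDiag, (n * (U.card : ℝ) - Θ q.1 - Θ q.2) ^ 2 := by
    calc (k : ℝ) * (k - 1) * c ^ 2
        = ∑ q ∈ (Finset.univ : Finset (Fin k)).offDiag,
          (2 * c * (n * U.card) - c ^ 2 - 2 * c * (Θ q.1 + Θ q.2)) := by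
          rw [Finset.sum_sub_distrib, ← Finset.mul_sum, hfst, Finset.sum_const, nsmul_eq_mul, hcard]
          have : n * (U.card : ℝ) = c + 2 * (∑ i, Θ i) / k := by rw [hc]; ring
          rw [this]
          field_simp
          ring
      _ ≤ _ := Finset.sum_le_sum fun q _ => by
          linarith [sq_nonneg (n * (U.card : ℝ) - Θ q.1 - Θ q.2 - c)]
  have hN2 : (0 : ℝ) ≤ (Fintype.card V : ℝ) ^ 2 := by positivity
  have hoff' := mul_le_mul_of_nonneg_right hoff hN2
  rw [hΘsum]
  refine le_of_mul_le_mul_left ?_ (by linarith : (0 : ℝ) < k)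
  linarith

end StarFree

end StarCover

end

/-! ### Assembling the counts -/

/-- `counts_contradiction` without the normalization. -/
lemma counts_contradiction_of_pos {n k ε δ N μ W Q G o L Θ M R : ℝ} (hn : 0 < n) (hk : 4 ≤ k)
    (hε : 0 < ε) (hε' : ε ≤ 1 / 2) (hδ : 0 ≤ δ) (hδ' : δ < ε ^ 3 / (3 * k ^ 2))
    (hN : (k - 1 / 2 + ε) * n < N)
    (hμ : 0 ≤ μ) (hW : 0 ≤ W) (hG : 0 ≤ G) (ho : 0 ≤ o) (hΘ : 0 ≤ Θ)
    (hM : M ≤ δ * N ^ 2) (hR : R = ε * N / (4 * k)) (hb : 0 ≤ N - μ - W)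
    (hbR : (N - μ - W) * R ≤ M)
    (hA : n * W - Q + G + o ≤ N * (k * n - N) + M)
    (hB : μ ^ 2 * Q - n * μ * L ≤ (μ ^ 2 + o) * G)
    (hC : 2 * Q ≤ n * W) (hD : L ≤ μ * R + Θ) (hE : o + Θ ≤ μ * (k * n - N + R))
    (hF : (k - 1) * (n * μ - 2 * Θ / k) ^ 2 ≤ o * N ^ 2) : False := by
  obtain ⟨N, rfl⟩ : ∃ N', N = n * N' := ⟨N / n, by field_simp⟩
  obtain ⟨μ, rfl⟩ : ∃ μ', μ = n * μ' := ⟨μ / n, by field_simp⟩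
  obtain ⟨W, rfl⟩ : ∃ W', W = n * W' := ⟨W / n, by field_simp⟩
  obtain ⟨R, rfl⟩ : ∃ R', R = n * R' := ⟨R / n, by field_simp⟩
  obtain ⟨Q, rfl⟩ : ∃ Q', Q = n ^ 2 * Q' := ⟨Q / n ^ 2, by field_simp⟩
  obtain ⟨G, rfl⟩ : ∃ G', G = n ^ 2 * G' := ⟨G / n ^ 2, by field_simp⟩
  obtain ⟨o, rfl⟩ : ∃ o', o = n ^ 2 * o' := ⟨o / n ^ 2, by field_simp⟩
  obtain ⟨L, rfl⟩ : ∃ L', L = n ^ 2 * L' := ⟨L / n ^ 2, by field_simp⟩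
  obtain ⟨Θ, rfl⟩ : ∃ Θ', Θ = n ^ 2 * Θ' := ⟨Θ / n ^ 2, by field_simp⟩
  obtain ⟨M, rfl⟩ : ∃ M', M = n ^ 2 * M' := ⟨M / n ^ 2, by field_simp⟩
  have hn2 : 0 < n ^ 2 := by positivity
  have hn4 : 0 < n ^ 4 := by positivity
  refine counts_contradiction (N := N) (μ := μ) (W := W) (Q := Q) (G := G) (o := o) (L := L)
    (Θ := Θ) (M := M) (R := R) hk hε hε' hδ hδ' ?_ ?_ ?_ ?_ ?_ ?_ ?_ ?_ ?_ ?_ ?_ ?_ ?_ ?_ ?_ ?_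
  · exact lt_of_mul_lt_mul_left (by linarith) hn.le
  · exact (mul_nonneg_iff_of_pos_left hn).1 hμ
  · exact (mul_nonneg_iff_of_pos_left hn).1 hW
  · exact (mul_nonneg_iff_of_pos_left hn2).1 hG
  · exact (mul_nonneg_iff_of_pos_left hn2).1 ho
  · exact (mul_nonneg_iff_of_pos_left hn2).1 hΘ
  · exact le_of_mul_le_mul_left (by linarith) hn2
  · refine mul_left_cancel₀ hn.ne' ?_
    rw [hR]
    ring
  · exact (mul_nonneg_iff_of_pos_left hn).1 (by linarith)
  · exact le_of_mul_le_mul_left (by linarith) hn2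
  · exact le_of_mul_le_mul_left (by linarith) hn2
  · exact le_of_mul_le_mul_left (by linarith) hn4
  · exact le_of_mul_le_mul_left (by linarith) hn2
  · exact le_of_mul_le_mul_left (by linarith) hn2
  · exact le_of_mul_le_mul_left (by linarith) hn2
  · refine le_of_mul_le_mul_left ?_ hn4
    calc n ^ 4 * ((k - 1) * (μ - 2 * Θ / k) ^ 2)
        = (k - 1) * (n * (n * μ) - 2 * (n ^ 2 * Θ) / k) ^ 2 := by ring
      _ ≤ _ := hF
      _ = _ := by ring

section

open scoped Classical

open StarCover

theorem StarCover.false_of_sum_uncovered_le {V : Type*} [Fintype V] {n k : ℕ} (hn : 0 < n)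
    (hk : 4 ≤ k) {ε δ : ℝ} (hε : 0 < ε) (hε' : ε ≤ 1 / 2) (hδ : 0 ≤ δ)
    (hδ' : δ < ε ^ 3 / (3 * (k : ℝ) ^ 2))
    (hV : ((k : ℝ) - 1 / 2 + ε) * n < (Fintype.card V : ℝ)) (D : Fin k → StarCover V n)
    (hM : ∑ x, ∑ y, uncovered D x y ≤ δ * (Fintype.card V : ℝ) ^ 2) : False := by
  have hk' : (4 : ℝ) ≤ k := by exact_mod_cast hk
  have hn' : (0 : ℝ) < n := by exact_mod_cast hn
  obtain ⟨prim, hprim⟩ : ∃ prim : V → Fin k, ∀ x ∈ allStars D, x ∈ (D (prim x)).star := by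
    have : ∀ x, ∃ i, x ∈ allStars D → x ∈ (D i).star := by
      intro x
      by_cases hx : x ∈ allStars D
      · obtain ⟨i, hi⟩ := (Finset.mem_filter.1 hx).2
        exact ⟨i, fun _ => hi⟩
      · exact ⟨⟨0, by omega⟩, fun h => absurd h hx⟩
    choose f hf using this
    exact ⟨f, hf⟩
  set N : ℝ := (Fintype.card V : ℝ) with hN
  set M := ∑ x, ∑ y, uncovered D x y with hMdef
  set R := ε * N / (4 * k) with hR
  have hN0 : 0 < N := by
    refine lt_trans ?_ hV
    have : (0 : ℝ) < k - 1 / 2 + ε := by linarith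
    positivity
  have hR0 : 0 < R := by positivity
  -- The cutoff `R` balances two needs: at most `M / R` star-free vertices are left out, and `k n -
  -- N + R` stays below `n / 2`.
  let U : Finset V := {u | u ∉ allStars D ∧ ∑ y, uncovered D u y ≤ R}
  have hUW : Disjoint U (allStars D) := by
    rw [Finset.disjoint_left]
    exact fun u hu => (Finset.mem_filter.1 hu).2.1
  have hUstar : ∀ u ∈ U, ∀ i, u ∉ (D i).star := by
    intro u hu i hi
    exact (Finset.mem_filter.1 hu).2.1 (by simpa [allStars] using ⟨i, hi⟩)
  have hUmiss : ∀ u ∈ U, ∑ y, uncovered D u y ≤ R := fun u hu => (Finset.mem_filter.1 hu).2.2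
  have hcard : N - U.card - (allStars D).card = ((U ∪ allStars D)ᶜ.card : ℝ) := by
    rw [Finset.card_compl, Nat.cast_sub (Finset.card_le_univ _), Finset.card_union_of_disjoint hUW]
    push_cast
    ring
  have hexc := sum_excess_add_le D
  have hstars := le_sum_sub_starDeg D hprim
  have hGo := sum_partCov_add_le D hprim hUW
  have hQ := sum_sq_card_piece_le D hprim
  have hexc0 := excess_nonneg D
  have ho0 : 0 ≤ ∑ u ∈ U, ∑ v ∈ U, excess D u v :=
    Finset.sum_nonneg fun u _ => Finset.sum_nonneg fun v _ => hexc0 u v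
  have hG0 : 0 ≤ ∑ q, ∑ x ∈ piece D prim q, ∑ y ∈ piece D prim q, partCov D x y :=
    Finset.sum_nonneg fun q _ => Finset.sum_nonneg fun x _ => Finset.sum_nonneg fun y _ =>
      partCov_nonneg D x y
  have hdef0 : ∀ u ∈ U, ∀ i, 0 ≤ defect D i u := fun u hu i =>
    ((D i).starDeg_nonneg u).trans (starDeg_le_defect D (hUstar u hu i))
  have hbR : (N - U.card - (allStars D).card) * R ≤ M := by
    rw [hcard, ← nsmul_eq_mul, ← Finset.sum_const]
    calc _ ≤ ∑ u ∈ (U ∪ allStars D)ᶜ, ∑ y, uncovered D u y := by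
          refine Finset.sum_le_sum fun u hu => ?_
          simp only [Finset.mem_compl, Finset.mem_union, U, Finset.mem_filter, Finset.mem_univ,
            true_and, not_or, not_and, not_le] at hu
          exact (hu.1 hu.2).le
      _ ≤ _ := Finset.sum_le_sum_of_subset_of_nonneg (Finset.subset_univ _)
          fun u _ _ => Finset.sum_nonneg fun y _ => uncovered_nonneg D u y
  have hWn : (0 : ℝ) ≤ n * (allStars D).card := by positivity
  -- the size of the graph is at most about `k * n`, so `R` is small
  have hRn : R ≤ ε * (1003 / 4000) * n := by
    have hb := error_bounds (N := N / n) (b := 0) (M := M / n ^ 2) (R := R / n) hk' hε hε' hδ hδ'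
      (by positivity) (by rw [div_pow, mul_div_assoc']; gcongr) (by rw [hR]; field_simp)
      (by rw [zero_mul]; refine div_nonneg ?_ (by positivity)
          exact Finset.sum_nonneg fun u _ => Finset.sum_nonneg fun y _ => uncovered_nonneg D u y)
      (by
        have : N / n * (k - N / n) + M / n ^ 2 = (N * (k * n - N) + M) / n ^ 2 := by
          field_simp
        rw [this]
        refine div_nonneg ?_ (by positivity)
        linarith)
    have := hb.2.2.1
    rwa [div_le_iff₀ hn'] at this
  have hu : ∀ u ∈ U, ∑ y, excess D u y + ∑ i, defect D i u ≤ k * n - N + R := by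
    intro u hu
    rw [sum_excess_add_sum_defect D hUstar hu]
    linarith [hUmiss u hu]
  -- Hence every single defect is below `n / 2`, which is the largeness of parts that
  -- `overlap_of_parts` needs.
  have hsmall : ∀ u ∈ U, ∑ i, defect D i u < n / 2 := by
    intro u huU
    have h1 := hu u huU
    have h2 : 0 ≤ ∑ y, excess D u y := Finset.sum_nonneg fun y _ => hexc0 u y
    have h3 : 0 < ε * n := by positivity
    linarith
  have hF := overlap_of_parts D hUstar hn (by omega)
    (fun u huU i => by
      have := Finset.single_le_sum (fun j _ => hdef0 u huU j) (Finset.mem_univ i)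
      linarith [hsmall u huU])
    (fun u huU => by linarith [hsmall u huU])
  have hB := overlap_of_stars D hUstar hprim
  refine counts_contradiction_of_pos hn' hk' hε hε' hδ hδ' hV (Nat.cast_nonneg U.card)
    (Nat.cast_nonneg (allStars D).card) hG0 ho0
    (Finset.sum_nonneg fun u huU => Finset.sum_nonneg fun i _ => hdef0 u huU i)
    hM hR ?_ hbR ?_ hB hQ ?_ ?_ hF
  · rw [hcard]
    positivity
  · linarith
  · rw [← nsmul_eq_mul, ← Finset.sum_const, ← Finset.sum_add_distrib]
    refine Finset.sum_le_sum fun u huU => add_le_add (hUmiss u huU) ?_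
    exact Finset.sum_le_sum fun i _ => starDeg_le_defect D (hUstar u huU i)
  · rw [← nsmul_eq_mul, ← Finset.sum_const, ← Finset.sum_add_distrib]
    refine Finset.sum_le_sum fun u huU => le_trans ?_ (hu u huU)
    exact add_le_add_left (Finset.sum_le_sum_of_subset_of_nonneg (Finset.subset_univ _)
      fun y _ _ => hexc0 u y) _

/-- The pairs that no cover contains are pairs of nonadjacent vertices. -/
lemma StarCover.sum_uncovered_le {V : Type*} [Fintype V] {n k : ℕ} (hk : 0 < k)
    (D : Fin k → StarCover V n) {G : SimpleGraph V} [Fintype G.edgeSet]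
    (hD : ∀ x y, G.Adj x y → ∃ i, (D i).Rel x y) :
    ∑ x, ∑ y, uncovered D x y + 2 * (G.edgeFinset.card : ℝ) ≤
      (Fintype.card V : ℝ) * (Fintype.card V - 1) := by
  have hdeg : 2 * (G.edgeFinset.card : ℝ) = ∑ x, (G.degree x : ℝ) := by
    have := G.sum_degrees_eq_twice_card_edges
    rw [← Nat.cast_sum, this]
    push_cast
    congr!
  rw [hdeg, ← Finset.sum_add_distrib]
  have hx : ∀ x, ∑ y, uncovered D x y + (G.degree x : ℝ) ≤ Fintype.card V - 1 := by
    intro x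
    have h1 : (G.degree x : ℝ) = ∑ y, if G.Adj x y then (1 : ℝ) else 0 := by
      rw [Finset.sum_boole, ← G.card_neighborFinset_eq_degree, neighborFinset_eq_filter]
    have h2 : (Fintype.card V : ℝ) - 1 = ∑ y, if y = x then (0 : ℝ) else 1 := by
      have : ∀ y, (if y = x then (0 : ℝ) else 1) = 1 - if y = x then 1 else 0 := by
        intro y; split_ifs <;> norm_num
      simp_rw [this]
      simp
    rw [h1, h2, ← Finset.sum_add_distrib]
    refine Finset.sum_le_sum fun y _ => ?_
    unfold uncovered
    by_cases hxy : G.Adj x y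
    · have h3 : ¬ ∀ i, ¬ (D i).Rel x y := by
        push Not
        exact hD x y hxy
      simp [hxy, h3, hxy.ne']
    -- Diagonal pairs belong to every cover, so they are never uncovered; this gives `N (N - 1)` and
    -- not `N²`.
    · by_cases he : y = x
      · subst he
        have h3 : ¬ ∀ i, ¬ (D i).Rel y y := by
          push Not
          exact ⟨⟨0, hk⟩, rfl, Or.inr (Or.inr rfl)⟩
        simp [h3]
      · simp only [hxy, he, if_false, add_zero]
        split_ifs <;> norm_num
  calc _ ≤ ∑ _x : V, ((Fintype.card V : ℝ) - 1) := Finset.sum_le_sum fun x _ => hx x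
    _ = _ := by rw [Finset.sum_const, Finset.card_univ, nsmul_eq_mul]

end

theorem theorem1 (k : ℕ) (hk : 4 ≤ k) (ε δ : ℝ) (hε : 0 < ε) (hε' : ε ≤ 1 / 2)
    (hδ : 0 ≤ δ) (hδ' : δ < ε ^ 3 / (3 * (k : ℝ) ^ 2))
    (n : ℕ) (hn : 4 ≤ n) (hn_even : Even n)
    {V : Type*} [Fintype V] (G : SimpleGraph V) [Fintype G.edgeSet]
    (hV : ((k : ℝ) - 1 / 2 + ε) * n < (Fintype.card V : ℝ))
    (hE : (1 - δ) * ((Fintype.card V).choose 2 : ℝ) ≤ (G.edgeFinset.card : ℝ))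
    (c : G.EdgeLabeling (Fin k)) :
    HasMonochromaticConnectedMatching c (n / 2) := by
  by_contra hno
  have hcov : ∀ i, ∃ D : StarCover V n, ∀ x y, (c.labelGraph i).Adj x y → D.Rel x y := by
    intro i
    have := exists_starCover (H := c.labelGraph i) (m := n / 2)
      fun M hM hcard => hno ⟨i, M, hM, hcard⟩
    rwa [Nat.two_mul_div_two_of_even hn_even] at this
  choose D hD using hcov
  have hadj : ∀ x y, G.Adj x y → ∃ i, (D i).Rel x y := fun x y h =>
    ⟨c ⟨s(x, y), h⟩, hD _ x y ((EdgeLabeling.labelGraph_adj x y).2 ⟨h, rfl⟩)⟩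
  have hM := StarCover.sum_uncovered_le (by omega) D hadj
  refine StarCover.false_of_sum_uncovered_le (by omega) hk hε hε' hδ hδ' hV D ?_
  rw [Nat.cast_choose_two] at hE
  have hN : (0 : ℝ) ≤ Fintype.card V := Nat.cast_nonneg _
  have : 0 ≤ δ * Fintype.card V := mul_nonneg hδ hN
  linarith
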